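/- **Setting.** Consider the compressible Navier–Stokes equations in two space dimensions, $\partial_t u+\sum_k\partial_k f_k(u)=\sum_k \partial_k f^V_k$, $u=(\rho,\rho u_1,\rho u_2,E)$, for an ideal gas, $p=(\gamma-1)\rho e$, $e=c_vT$, $E=\rho e+\tfrac12\rho|\mathbf u|^2$, with velocity $\mathbf u=(u_1,u_2)$ and constants $\gamma>1$, $c_v>0$, $\mu,\kappa\ge 0$, $\mathrm{Re}>0$, inviscid fluxes $f_k$, and viscous fluxes $f^V_i=\frac1{\mathrm{Re}}(0,\tau_{i1},\tau_{i2},\tau_{i1}u_1+\tau_{i2}u_2+\kappa\,\partial_iT)$, $\tau_{ij}=\mu(\partial_iu_j+\partial_ju_i)-\tfrac23\mu\,\delta_{ij}\,\mathrm{div}\,\mathbf u$. A state is admissible if $\rho>0$ and $\rho e>0$. Let $\eta(u)=-\rho s/(\gamma-1)$, $s=\log(p/\rho^\gamma)$, be the entropy, $v=\nabla_u\eta$ the entropy variables, $\psi_k=v^Tf_k-\eta u_k$ the entropy potentials, and $K_{ij}(u)$ the blocks of the symmetric matrix with $f^V_i=\sum_jK_{ij}\partial_jv$. **Mesh and operators.**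 Each of finitely many elements carries nodes with positive weights (diagonal mass matrix $M=\mathrm{diag}(m_i)$), surface points, each located at a node (extraction matrix $E$), with weights $w^f>0$ and unit outward normals $\hat n$, boundary matrices $B_k=\mathrm{diag}(w^f\hat n_k)$, and high- and low-order matrices $Q_k$, $Q_k^L$ with $$Q_k+Q_k^T=E^TB_kE=Q^L_k+(Q^L_k)^T,\qquad Q_k\mathbf 1=Q_k^L\mathbf 1=0\qquad(k=1,2).$$ The domain is periodic: every surface point of every element is matched with exactly one exterior surface point, with the same weight and opposite normal; $a^+$ denotes the exterior value of $a$ there. **Schemes.** Let $f_{k,S}$ be numerical fluxes that on admissible states are symmetric, consistent with $f_k$ and entropy conservative, $(v_L-v_R)^Tf_{k,S}(u_L,u_R)=\psi_k(u_L)-\psi_k(u_R)$. Let $\lambda_{\max}(u_L,u_R,n)$, for unit vectors $n$, bound the wave speeds of the Euler Riemann problem in direction $n$: it has a self-similar weak entropy solution (vacuum allowed) that equals $u_L$ for $x/t<-\lambda_{\max}$ and $u_R$ for $x/t>\lambda_{\max}$; let $\lambda_{\max}(u_R,u_L,-n)=\lambda_{\max}(u_L,u_R,n)$. For nodal viscous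 fluxes $\sigma=(\sigma_1,\sigma_2)$ and $\varepsilon_0>0$ put $$\beta(u,\sigma,n)=\varepsilon_0+|n\cdot\mathbf u|+\frac{\sqrt{\rho^2(q\cdot n)^2+2\rho^2e\,|n\cdot\tau-pn|^2}+\rho|q\cdot n|}{2\rho^2e},$$ $(n\cdot\tau)_k=n_1(\sigma_k)_2+n_2(\sigma_k)_3$, $q_k=u_1(\sigma_k)_2+u_2(\sigma_k)_3-(\sigma_k)_4$, and $\alpha(u_L,u_R,\sigma_L,\sigma_R,n)=\max\{\lambda_{\max}(u_L,u_R,n),\beta(u_L,\sigma_L,n),\beta(u_R,\sigma_R,n)\}$. Let $n_{ij}=\tfrac12\big((Q_k^L-(Q_k^L)^T)_{ij}\big)_{k=1,2}$, $\lambda_{ij}=\alpha(u_i,u_j,\sigma_i,\sigma_j,n_{ij}/|n_{ij}|)\,|n_{ij}|$ (zero if $n_{ij}=0$) and, at a surface point, $\lambda_k=\tfrac12|B_k|\,\alpha(u,u^+,\sigma,\sigma^+,\hat n)$. The low- and high-order residuals at node $i$ of an element are $$r^L_i=\sum_j\Big[\sum_k\tfrac12(Q^L_k-(Q^L_k)^T)_{ij}\big(f_k(u_i)+f_k(u_j)-\sigma_{k,i}-\sigma_{k,j}\big)-\lambda_{ij}(u_j-u_i)\Big]+b_i,$$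 $$r^H_i=\sum_{j,k}(Q_k-Q_k^T)_{ij}\big(f_{k,S}(u_i,u_j)-\tfrac12(\sigma_{k,i}+\sigma_{k,j})\big)+b_i,$$ with the same local Lax–Friedrichs type interface term $$b=\sum_kE^T\big[\tfrac12B_k\big(f_k(u)+f_k(u^+)-\sigma_k-\sigma_k^+\big)-\lambda_k(u^+-u)\big].$$ The forward Euler updates with time step $\Delta t$ are $u_i^L=u_i-\frac{\Delta t}{m_i}r_i^L$ and $u_i^H=u_i-\frac{\Delta t}{m_i}r_i^H$. Given $l^e\in[0,1]$ on each element $e$, the limited update is $u_i^{n+1}=u_i^L+\frac{\Delta t}{m_i}l^e(r_i^L-r_i^H)$, and the semi-discrete limited scheme is $M\frac{du}{dt}+(1-l^e)r^L+l^er^H=0$ on each element $e$, where $\sigma_i=\sum_jK_{ij}\Theta_j$ and $\Theta_k$ is the same elementwise combination of the low- and high-order discrete gradients of $v$, $$M\Theta_k=(1-l^e)\tfrac12\big(Q_k^L-(Q_k^L)^T\big)v+l^e\,\tfrac12\big(Q_k-Q_k^T\big)v+\tfrac12E^TB_kv^+ .$$ **Theorem.** For every choice of the parameters $l^e\in[0,1]$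 (in particular that of the Zhang–Shu limiter; they may vary from element to element and in time): 1. For admissible nodal values $u$, any $\sigma$ and any $\Delta t>0$, the limited update is $u^{n+1}=(1-l^e)u^L+l^eu^H$ on each element $e$, and it is conservative: $\sum_e\mathbf 1^TMu^{n+1}=\sum_e\mathbf 1^TMu$. 2. At every time at which the nodal values are admissible and differentiable and satisfy the semi-discrete limited scheme, $\frac{d}{dt}\sum_e\mathbf 1^TMu=0$ and $$\frac{d}{dt}\sum_e\mathbf 1^TM\,\eta(u)\;\le\;-\sum_e\sum_{i,j=1}^2\Theta_i^TM\,K_{ij}\,\Theta_j .$$ -/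

import Mathlib

open scoped Matrix

noncomputable section

namespace ESDG

/-! ### Compressible Navier-Stokes equations in two space dimensions -/

/-- Conservative variables `(ρ, ρ u, ρ v, E)`. -/
abbrev State := Fin 4 → ℝ

/-- Physical parameters: ratio of specific heats, specific heat capacity, dynamic viscosity, heat
conductivity and Reynolds number. Zero viscosity and conductivity (Euler) is allowed. -/
structure Gas where
  γ : ℝ
  cv : ℝ
  μ : ℝ
  κ : ℝ
  Re : ℝ
  one_lt_γ : 1 < γ
  cv_pos : 0 < cv
  μ_nonneg : 0 ≤ μ
  κ_nonneg : 0 ≤ κ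
  Re_pos : 0 < Re

/-- The velocity `(u, v)`. -/
def velocity (u : State) : Fin 2 → ℝ := ![u 1 / u 0, u 2 / u 0]

/-- The internal energy per volume, `ρ e = E - ρ (u² + v²) / 2`. -/
def rhoE (u : State) : ℝ := u 3 - (u 1 ^ 2 + u 2 ^ 2) / (2 * u 0)

/-- The specific internal energy `e`. -/
def specificEnergy (u : State) : ℝ := rhoE u / u 0

/-- Positive density and positive internal energy. -/
def admissible : Set State := {u | 0 < u 0 ∧ 0 < rhoE u}

/-- Kronecker delta. -/
def kd (i j : Fin 2) : ℝ := if i = j then 1 else 0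

/-- Euclidean norm of a plane vector. -/
def norm2 (n : Fin 2 → ℝ) : ℝ := Real.sqrt (n 0 ^ 2 + n 1 ^ 2)

/-- `n / |n|`. -/
def normalize (n : Fin 2 → ℝ) : Fin 2 → ℝ := (norm2 n)⁻¹ • n

namespace Gas

variable (G : Gas)

/-- `p = (γ - 1) ρ e`. -/
def pressure (u : State) : ℝ := (G.γ - 1) * rhoE u

/-- Inviscid flux in the coordinate direction `k`. -/
def flux (k : Fin 2) (u : State) : State :=
  ![u 0 * velocity u k,
    u 1 * velocity u k + kd 0 k * G.pressure u,
    u 2 * velocity u k + kd 1 k * G.pressure u,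
    (u 3 + G.pressure u) * velocity u k]

/-- Inviscid flux in the direction `n`. -/
def normalFlux (n : Fin 2 → ℝ) (u : State) : State := ∑ k, n k • G.flux k u

/-- The physical entropy `s = log (p / ρ^γ)`. -/
def physEntropy (u : State) : ℝ := Real.log (G.pressure u / u 0 ^ G.γ)

/-- The mathematical entropy `η = -ρ s / (γ - 1)`. -/
def entropy (u : State) : ℝ := -(u 0 * G.physEntropy u) / (G.γ - 1)

/-- The entropy variables, i.e. the gradient of `η` with respect to the conservative variables
(see `hasFDerivAt_entropy`). -/
def entropyVar (u : State) : State :=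
  (G.γ - 1)⁻¹ •
    ![G.γ + 1 - G.physEntropy u - u 3 / rhoE u,
      velocity u 0 / specificEnergy u,
      velocity u 1 / specificEnergy u,
      -1 / specificEnergy u]

theorem hasFDerivAt_entropy {u : State} (hu : u ∈ admissible) :
    HasFDerivAt G.entropy
      (∑ a, G.entropyVar u a • ContinuousLinearMap.proj (R := ℝ) (φ := fun _ : Fin 4 => ℝ) a) u := by
  obtain ⟨h0, h1⟩ := hu
  have hg : 0 < G.γ - 1 := sub_pos.2 G.one_lt_γ
  have hp (a : Fin 4) : HasFDerivAt (fun w : State => w a)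
      (ContinuousLinearMap.proj (R := ℝ) (φ := fun _ : Fin 4 => ℝ) a) u :=
    hasFDerivAt_apply a u
  have hr : HasFDerivAt rhoE _ u :=
    (hp 3).sub ((((hp 1).pow 2).add ((hp 2).pow 2)).mul
      (HasDerivAt.comp_hasFDerivAt u (hasDerivAt_inv (by positivity : (2 * u 0) ≠ 0))
        ((hp 0).const_mul 2)))
  have hev : G.entropy =ᶠ[nhds u] fun w =>
      -(w 0 * (Real.log (G.γ - 1) + Real.log (rhoE w) - G.γ * Real.log (w 0))) * (G.γ - 1)⁻¹ := by
    filter_upwards [(hp 0).continuousAt.eventually (lt_mem_nhds h0),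
      hr.continuousAt.eventually (lt_mem_nhds h1)] with w hw0 hw1
    simp only [entropy, physEntropy, pressure]
    rw [Real.log_div (by positivity) (by positivity), Real.log_mul hg.ne' hw1.ne',
      Real.log_rpow hw0, div_eq_mul_inv]
  refine HasFDerivAt.congr_of_eventuallyEq ?_ hev
  refine (((hp 0).mul (((hr.log h1.ne').const_add _).sub
    (((hp 0).log h0.ne').const_mul _))).neg.mul_const _).congr_fderiv ?_
  ext w
  have hs : G.physEntropy u
      = Real.log (G.γ - 1) + Real.log (rhoE u) - G.γ * Real.log (u 0) := by
    simp only [physEntropy, pressure]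
    rw [Real.log_div (by positivity) (by positivity), Real.log_mul hg.ne' h1.ne',
      Real.log_rpow h0]
  have hE : u 3 = rhoE u + (u 1 ^ 2 + u 2 ^ 2) / (2 * u 0) := by simp [rhoE]
  simp [Fin.sum_univ_four, entropyVar, velocity, specificEnergy, hs]
  rw [hE]
  generalize rhoE u = r at *
  field_simp
  ring

/-- The entropy flux in direction `n` is `η (u · n)`. -/
def entropyFlux (n : Fin 2 → ℝ) (u : State) : ℝ := G.entropy u * (n ⬝ᵥ velocity u)

/-- The entropy potential `ψ_k = vᵀ f_k - η u_k`. -/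
def entropyPotential (k : Fin 2) (u : State) : ℝ :=
  G.entropyVar u ⬝ᵥ G.flux k u - G.entropy u * velocity u k

/-- The state vector with a unit entry in the momentum slot `a` and `u_a` in the energy slot. For a
vector `g` of derivatives of the entropy variables in direction `j`, the derivative of `u_a` in
direction `j` is `(γ - 1) e (w_a · g)`. -/
def stressDir (u : State) (a : Fin 2) : State := ![0, kd a 0, kd a 1, velocity u a]

/-- The blocks `K_ij` of the matrix that symmetrizes the viscous fluxes, `f^V_i = ∑ j, K_ij ∂_j v`,
where `v` are the entropy variables and
`f^V_i = (1 / Re) (0, τ_i1, τ_i2, τ_i1 u + τ_i2 v + κ ∂_i T)`, with `e = c_v T` and the Newtonian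
stress `τ_ia = μ (∂_i u_a + ∂_a u_i) - (2/3) μ δ_ia (div u)`. -/
def viscMatrix (u : State) (i j : Fin 2) : Matrix (Fin 4) (Fin 4) ℝ :=
  (1 / G.Re) •
    (((G.γ - 1) * specificEnergy u) •
        (∑ a, ∑ b,
          (G.μ * (kd i j * kd a b + kd i b * kd a j) - 2 / 3 * G.μ * (kd i a * kd j b)) •
            Matrix.vecMulVec (stressDir u a) (stressDir u b)) +
      (G.κ / G.cv * (G.γ - 1) * specificEnergy u ^ 2 * kd i j) •
        Matrix.vecMulVec (![0, 0, 0, 1] : State) ![0, 0, 0, 1])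

/-- Tadmor's entropy conservative numerical flux in direction `k`: symmetric, consistent, entropy
conservative. -/
structure IsEntropyConservativeFlux (k : Fin 2) (fS : State → State → State) : Prop where
  symm : ∀ uL ∈ admissible, ∀ uR ∈ admissible, fS uL uR = fS uR uL
  consistent : ∀ u ∈ admissible, fS u u = G.flux k u
  conservative : ∀ uL ∈ admissible, ∀ uR ∈ admissible,
    (G.entropyVar uL - G.entropyVar uR) ⬝ᵥ fS uL uR
      = G.entropyPotential k uL - G.entropyPotential k uR

/-- `w(x, t) = U (x / t)` is a self-similar weak entropy solution of the Euler Riemann problem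
`∂_t w + ∂_x (n · f(w)) = 0` with data `uL` (left), `uR` (right), and all its waves have speeds in
`[-lam, lam]`. Vacuum (the zero state) may occur. In the variable `ξ = x / t` the conservation law
reads `(n · f(U) - ξ U)' + U = 0`, and the entropy inequality `(q(U) - ξ η(U))' + η(U) ≤ 0`, both in
the sense of distributions. -/
structure IsRiemannSolution (n : Fin 2 → ℝ) (uL uR : State) (lam : ℝ) (U : ℝ → State) :
    Prop where
  mem : ∀ ξ, U ξ ∈ admissible ∨ U ξ = 0
  left : ∀ ξ, ξ < -lam → U ξ = uL
  right : ∀ ξ, lam < ξ → U ξ = uR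
  integrable_state : MeasureTheory.LocallyIntegrable U
  integrable_flux : MeasureTheory.LocallyIntegrable fun ξ => G.normalFlux n (U ξ)
  integrable_entropy : MeasureTheory.LocallyIntegrable fun ξ => G.entropy (U ξ)
  integrable_entropyFlux : MeasureTheory.LocallyIntegrable fun ξ => G.entropyFlux n (U ξ)
  weak : ∀ φ : ℝ → ℝ, ContDiff ℝ (⊤ : ℕ∞) φ → HasCompactSupport φ →
    ∫ ξ, deriv φ ξ • (G.normalFlux n (U ξ) - ξ • U ξ) = ∫ ξ, φ ξ • U ξ
  entropy_ineq : ∀ φ : ℝ → ℝ, ContDiff ℝ (⊤ : ℕ∞) φ → HasCompactSupport φ → (∀ ξ, 0 ≤ φ ξ) →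
    ∫ ξ, φ ξ * G.entropy (U ξ)
      ≤ ∫ ξ, deriv φ ξ * (G.entropyFlux n (U ξ) - ξ * G.entropy (U ξ))

/-- `lamMax uL uR n` bounds the wave speeds of the Riemann problem in the unit direction `n`. Like
the exact wave speed, it takes the same value from the two sides of an interface. -/
structure IsWaveSpeedBound (lamMax : State → State → (Fin 2 → ℝ) → ℝ) : Prop where
  bound : ∀ uL ∈ admissible, ∀ uR ∈ admissible, ∀ n, norm2 n = 1 →
    ∃ U, G.IsRiemannSolution n uL uR (lamMax uL uR n) U
  symm : ∀ uL ∈ admissible, ∀ uR ∈ admissible, ∀ n, norm2 n = 1 →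
    lamMax uR uL (-n) = lamMax uL uR n

/-- Zhang's viscosity coefficient `β(u, σ, n)` for a unit vector `n`; `σ k` is the viscous flux in
direction `k`. -/
def zhangBeta (ε₀ : ℝ) (u : State) (σ : Fin 2 → State) (n : Fin 2 → ℝ) : ℝ :=
  let q : Fin 2 → ℝ := fun k => velocity u 0 * σ k 1 + velocity u 1 * σ k 2 - σ k 3
  let nτ : Fin 2 → ℝ := fun k => n 0 * σ k 1 + n 1 * σ k 2
  let e := specificEnergy u
  ε₀ + |n ⬝ᵥ velocity u| +
    1 / (2 * u 0 ^ 2 * e) *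
      (Real.sqrt (u 0 ^ 2 * (q ⬝ᵥ n) ^ 2
          + 2 * u 0 ^ 2 * e * norm2 (nτ - G.pressure u • n) ^ 2)
        + u 0 * |q ⬝ᵥ n|)

/-- The dissipation coefficient: the largest of the wave speed bound and of the two values of
`β`. -/
def dissipation (ε₀ : ℝ) (lamMax : State → State → (Fin 2 → ℝ) → ℝ)
    (uL uR : State) (σL σR : Fin 2 → State) (n : Fin 2 → ℝ) : ℝ :=
  max (lamMax uL uR n) (max (G.zhangBeta ε₀ uL σL n) (G.zhangBeta ε₀ uR σR n))

end Gas

/-! ### Summation-by-parts operators and periodic meshes -/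

section Mesh

/-- The face extraction matrix `E`: entry `1` where the surface point is the volume node. -/
def extraction {ι φ : Type*} [DecidableEq ι] (faceNode : φ → ι) : Matrix φ ι ℝ :=
  Matrix.of fun f i => if faceNode f = i then 1 else 0

/-- The diagonal-norm operators of one element, with volume nodes `ι` and surface quadrature points
`φ` (a corner node may carry several surface points): the diagonal `m` of the mass matrix, surface
weights and unit outward normals, the weighted differentiation matrices `Q k` of the high order
scheme and `QL k` of the low order scheme. Both satisfy the summation-by-parts property with the
boundary matrix `B k = diag (w^f n_k)` and annihilate constants. -/
structure SBPElement (ι φ : Type*) [Fintype ι] [DecidableEq ι] [Fintype φ] [DecidableEq φ] where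
  m : ι → ℝ
  m_pos : ∀ i, 0 < m i
  faceNode : φ → ι
  wf : φ → ℝ
  wf_pos : ∀ f, 0 < wf f
  normal : φ → Fin 2 → ℝ
  normal_unit : ∀ f, norm2 (normal f) = 1
  Q : Fin 2 → Matrix ι ι ℝ
  QL : Fin 2 → Matrix ι ι ℝ
  sbp : ∀ k, Q k + (Q k)ᵀ
    = (extraction faceNode)ᵀ * Matrix.diagonal (fun f => wf f * normal f k) * extraction faceNode
  sbpL : ∀ k, QL k + (QL k)ᵀ
    = (extraction faceNode)ᵀ * Matrix.diagonal (fun f => wf f * normal f k) * extraction faceNode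
  Q_one : ∀ k, Q k *ᵥ 1 = 0
  QL_one : ∀ k, QL k *ᵥ 1 = 0

variable {κ ι φ : Type*} [Fintype κ] [Fintype ι] [DecidableEq ι] [Fintype φ] [DecidableEq φ]

/-- Entries of the diagonal boundary integration matrices. -/
def SBPElement.B (D : SBPElement ι φ) (k : Fin 2) (f : φ) : ℝ := D.wf f * D.normal f k

/-- The vectors `n_ij` made of the entries of `(QL k - (QL k)ᵀ) / 2`. -/
def SBPElement.nij (D : SBPElement ι φ) (i j : ι) : Fin 2 → ℝ :=
  fun k => (D.QL k i j - D.QL k j i) / 2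

/-- A periodic mesh with elements `κ`: every surface point of every element coincides (modulo the
periods) with exactly one surface point of a neighboring element, where the surface weight is the
same and the outward normal is opposite. -/
structure PeriodicMesh (κ ι φ : Type*) [Fintype ι] [DecidableEq ι] [Fintype φ]
    [DecidableEq φ] where
  elem : κ → SBPElement ι φ
  nbr : κ × φ → κ × φ
  nbr_nbr : ∀ x, nbr (nbr x) = x
  wf_nbr : ∀ x, (elem (nbr x).1).wf (nbr x).2 = (elem x.1).wf x.2
  normal_nbr : ∀ x, (elem (nbr x).1).normal (nbr x).2 = -(elem x.1).normal x.2

namespace PeriodicMesh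

variable (T : PeriodicMesh κ ι φ)

/-- Interior trace at a surface point. -/
def inner {X : Type*} (a : κ → ι → X) (e : κ) (f : φ) : X := a e ((T.elem e).faceNode f)

/-- Exterior trace `a⁺` at a surface point: the value on the neighboring element. -/
def outer {X : Type*} (a : κ → ι → X) (e : κ) (f : φ) : X :=
  T.inner a (T.nbr (e, f)).1 (T.nbr (e, f)).2

/-- `1ᵀ M a`, the quadrature of the nodal values `a` over the whole domain. -/
def integral {X : Type*} [AddCommMonoid X] [Module ℝ X] (a : κ → ι → X) : X :=
  ∑ e, ∑ i, (T.elem e).m i • a e i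

/-- Local discontinuous Galerkin gradient of `v` in direction `k`, with respect to a family of
summation-by-parts matrices:
`M Θ_k = (1/2) (Q_k - Q_kᵀ) v + (1/2) Eᵀ B_k v⁺`. -/
def ldgGradient (Q : κ → Fin 2 → Matrix ι ι ℝ) (v : κ → ι → State) (k : Fin 2) (e : κ) (i : ι) :
    State :=
  ((T.elem e).m i)⁻¹ •
    (∑ j, ((Q e k i j - Q e k j i) / 2) • v e j
      + ∑ f with (T.elem e).faceNode f = i, ((T.elem e).B k f / 2) • T.outer v e f)

end PeriodicMesh

/-! ### The low order, high order and limited schemes -/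

/-- The data of the discretization: the gas, a wave speed estimate, the number `ε₀` in `β`, the two
numerical volume fluxes of the high order scheme and the mesh. -/
structure Scheme (κ ι φ : Type*) [Fintype ι] [DecidableEq ι] [Fintype φ] [DecidableEq φ] where
  gas : Gas
  ε₀ : ℝ
  ε₀_pos : 0 < ε₀
  lamMax : State → State → (Fin 2 → ℝ) → ℝ
  lamMax_bound : gas.IsWaveSpeedBound lamMax
  fS : Fin 2 → State → State → State
  fS_conservative : ∀ k, gas.IsEntropyConservativeFlux k (fS k)
  mesh : PeriodicMesh κ ι φ

namespace Scheme

variable (S : Scheme κ ι φ)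

/-- Nodal values of the entropy variables. -/
def v (u : κ → ι → State) (e : κ) (i : ι) : State := S.gas.entropyVar (u e i)

/-- Discrete gradient `Θ_k` of the entropy variables in the limited scheme with blending
parameters `l e`: on each element, the combination of the low order and the high order gradients. -/
def Theta (l : κ → ℝ) (u : κ → ι → State) (k : Fin 2) (e : κ) (i : ι) : State :=
  (1 - l e) • S.mesh.ldgGradient (fun e => (S.mesh.elem e).QL) (S.v u) k e i
    + l e • S.mesh.ldgGradient (fun e => (S.mesh.elem e).Q) (S.v u) k e i

/-- Discrete viscous fluxes `σ_k = K_k1 Θ_1 + K_k2 Θ_2`. -/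
def sigma (l : κ → ℝ) (u : κ → ι → State) (k : Fin 2) (e : κ) (i : ι) : State :=
  ∑ j, S.gas.viscMatrix (u e i) k j *ᵥ S.Theta l u j e i

/-- Graph viscosity coefficients `λ_ij` on the element `e`. -/
def graphVisc (u : κ → ι → State) (σ : Fin 2 → κ → ι → State) (e : κ) (i j : ι) : ℝ :=
  S.gas.dissipation S.ε₀ S.lamMax (u e i) (u e j) (fun k => σ k e i) (fun k => σ k e j)
      (normalize ((S.mesh.elem e).nij i j))
    * norm2 ((S.mesh.elem e).nij i j)

/-- Interface penalization coefficients `λ_k` at a surface point. -/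
def faceVisc (u : κ → ι → State) (σ : Fin 2 → κ → ι → State) (k : Fin 2) (e : κ) (f : φ) : ℝ :=
  |(S.mesh.elem e).B k f| / 2 *
    S.gas.dissipation S.ε₀ S.lamMax (S.mesh.inner u e f) (S.mesh.outer u e f)
      (fun k => S.mesh.inner (σ k) e f) (fun k => S.mesh.outer (σ k) e f)
      ((S.mesh.elem e).normal f)

/-- The interface contribution `∑ k, Eᵀ (B_k f_k^* - λ_k ⟦u⟧)` at a node, with local Lax-Friedrichs
type interface fluxes. It is common to the low and the high order scheme. -/
def interface (u : κ → ι → State) (σ : Fin 2 → κ → ι → State) (e : κ) (i : ι) : State :=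
  ∑ f with (S.mesh.elem e).faceNode f = i, ∑ k,
    (((S.mesh.elem e).B k f / 2) •
        (S.gas.flux k (S.mesh.inner u e f) + S.gas.flux k (S.mesh.outer u e f)
          - S.mesh.inner (σ k) e f - S.mesh.outer (σ k) e f)
      - S.faceVisc u σ k e f • (S.mesh.outer u e f - S.mesh.inner u e f))

/-- Residual `r^L` of the low order scheme. -/
def lowResidual (u : κ → ι → State) (σ : Fin 2 → κ → ι → State) (e : κ) (i : ι) : State :=
  ∑ j, (∑ k, (((S.mesh.elem e).QL k i j - (S.mesh.elem e).QL k j i) / 2) •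
          (S.gas.flux k (u e i) + S.gas.flux k (u e j) - σ k e i - σ k e j)
        - S.graphVisc u σ e i j • (u e j - u e i))
    + S.interface u σ e i

/-- Residual `r^H` of the high order entropy stable scheme. -/
def highResidual (u : κ → ι → State) (σ : Fin 2 → κ → ι → State) (e : κ) (i : ι) : State :=
  ∑ j, ∑ k, ((S.mesh.elem e).Q k i j - (S.mesh.elem e).Q k j i) •
          (S.fS k (u e i) (u e j) - (1 / 2 : ℝ) • (σ k e i + σ k e j))
    + S.interface u σ e i

/-- Forward Euler update of the low order scheme, `m_i (u^L - u) / τ + r^L = 0`. -/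
def lowUpdate (τ : ℝ) (u : κ → ι → State) (σ : Fin 2 → κ → ι → State) (e : κ) (i : ι) : State :=
  u e i - (τ / (S.mesh.elem e).m i) • S.lowResidual u σ e i

/-- Forward Euler update of the high order scheme, `m_i (u^H - u) / τ + r^H = 0`. -/
def highUpdate (τ : ℝ) (u : κ → ι → State) (σ : Fin 2 → κ → ι → State) (e : κ) (i : ι) : State :=
  u e i - (τ / (S.mesh.elem e).m i) • S.highResidual u σ e i

/-- The elementwise limited update, `m_i u^{n+1} = m_i u^L + τ l (r^L - r^H)`. -/
def limitedUpdate (τ : ℝ) (l : κ → ℝ) (u : κ → ι → State) (σ : Fin 2 → κ → ι → State) (e : κ)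
    (i : ι) : State :=
  S.lowUpdate τ u σ e i
    + (τ / (S.mesh.elem e).m i * l e) • (S.lowResidual u σ e i - S.highResidual u σ e i)

/-- The time derivative `du` of the nodal values satisfies the semi-discrete limited scheme
`M du/dt + (1 - l) r^L + l r^H = 0` at the nodal values `u`, on each element. -/
def SemiDiscrete (l : κ → ℝ) (u du : κ → ι → State) : Prop :=
  ∀ e i, (S.mesh.elem e).m i • du e i
    + (1 - l e) • S.lowResidual u (S.sigma l u) e i
    + l e • S.highResidual u (S.sigma l u) e i = 0

/-- `∑ i j, Θ_iᵀ M K_ij Θ_j`, summed over all elements. -/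
def viscousDissipation (l : κ → ℝ) (u : κ → ι → State) : ℝ :=
  ∑ i, ∑ j, S.mesh.integral fun e x =>
    S.Theta l u i e x ⬝ᵥ (S.gas.viscMatrix (u e x) i j *ᵥ S.Theta l u j e x)

end Scheme

end Mesh

end ESDG

end

open ESDG

/-!
The heart of the matter is Tadmor's condition
`(v_R - v_L)ᵀ (½ (f_L + f_R) - ½ Λ (u_R - u_L)) ≤ ψ_R - ψ_L` for the local Lax-Friedrichs flux in a
unit direction, for every `Λ > 0` that bounds the wave speeds
(`Gas.dotProduct_laxFriedrichs_le`). The entropy is convex, so the relative entropy with respect to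
either of the two data is nonnegative along the Riemann solution, also in vacuum
(`Gas.relEntropy_nonneg`). Relative entropies inherit the entropy inequality; testing it with a bump
function that equals one on the wave fan gives one inequality between the outer states for each of
the two data (`Gas.entropyFlux_sub_le`), and their sum is Tadmor's condition. The coefficient `β`
enters only through `β > 0` and its symmetry.

The rest is summation by parts. Volume and interface fluxes are antisymmetric under exchange of the
two nodes or of the two sides, which gives conservation, and also shows that testing with the entropy
variables only involves differences `v_j - v_i`. Tadmor's condition, or entropy conservation for the
high order fluxes, replaces these by differences of entropy potentials; summation by parts turns them
into boundary values (`le_sum_dotProduct_volume`), the same for the low and the high order residual,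
and these cancel with the interface terms (`Scheme.le_sum_dotProduct_interface`). In the viscous
terms, the skew-symmetric operators move from `σ` to `v`, which produces the discrete gradient `Θ`
with the same blending parameters on each element as in the residual
(`Scheme.viscousDissipation_le`).
-/

open ESDG

namespace ESDG

open MeasureTheory Set

/-! ### Convexity of the entropy -/

theorem Gas.physEntropy_eq (G : Gas) {u : State} (hu : u ∈ admissible) :
    G.physEntropy u = Real.log (G.γ - 1) + Real.log (rhoE u) - G.γ * Real.log (u 0) := by
  obtain ⟨h0, h1⟩ := hu
  have hg : 0 < G.γ - 1 := sub_pos.2 G.one_lt_γ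
  simp only [physEntropy, pressure]
  rw [Real.log_div (by positivity) (by positivity), Real.log_mul hg.ne' h1.ne', Real.log_rpow h0]

/-- Since `vᵀ u - η = ρ`, the tangent plane of `η` at `a` is `w ↦ vᵀ(a) w - ρ(a)`. -/
theorem Gas.entropyVar_dotProduct_self (G : Gas) {a : State} (ha : a ∈ admissible) :
    G.entropyVar a ⬝ᵥ a = G.entropy a + a 0 := by
  obtain ⟨h0, h1⟩ := ha
  have hg : 0 < G.γ - 1 := sub_pos.2 G.one_lt_γ
  have hE : a 3 = rhoE a + (a 1 ^ 2 + a 2 ^ 2) / (2 * a 0) := by simp [rhoE]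
  simp only [dotProduct, Fin.sum_univ_four, entropyVar, entropy, velocity, specificEnergy,
    Pi.smul_apply, smul_eq_mul, Matrix.cons_val]
  rw [hE]
  generalize rhoE a = r at *
  field_simp
  ring

/-- The graph of the entropy lies above its tangent planes. After separating off a nonnegative
multiple of the squared velocity difference, this is `log x ≤ x - 1`, applied to the quotients of the
specific internal energies and of the densities. -/
theorem Gas.entropyVar_dotProduct_le (G : Gas) {a w : State} (ha : a ∈ admissible)
    (hw : w ∈ admissible) : G.entropyVar a ⬝ᵥ w ≤ G.entropy w + a 0 := by
  have hsa := G.physEntropy_eq ha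
  have hsw := G.physEntropy_eq hw
  obtain ⟨h0, h1⟩ := ha
  obtain ⟨w0, w1⟩ := hw
  have hg : 0 < G.γ - 1 := sub_pos.2 G.one_lt_γ
  have hE : a 3 = rhoE a + (a 1 ^ 2 + a 2 ^ 2) / (2 * a 0) := by simp [rhoE]
  have hF : w 3 = rhoE w + (w 1 ^ 2 + w 2 ^ 2) / (2 * w 0) := by simp [rhoE]
  have l1 : Real.log (rhoE w) - Real.log (w 0) - (Real.log (rhoE a) - Real.log (a 0))
      ≤ rhoE w * a 0 / (w 0 * rhoE a) - 1 := by
    have h := Real.log_le_sub_one_of_pos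
      (x := rhoE w * a 0 / (w 0 * rhoE a)) (by positivity)
    rw [Real.log_div (by positivity) (by positivity), Real.log_mul w1.ne' h0.ne',
      Real.log_mul w0.ne' h1.ne'] at h
    linarith
  have l2 : Real.log (a 0) - Real.log (w 0) ≤ a 0 / w 0 - 1 := by
    have h := Real.log_le_sub_one_of_pos (x := a 0 / w 0) (by positivity)
    rwa [Real.log_div h0.ne' w0.ne'] at h
  have key : 0 ≤ (rhoE w * a 0 / (w 0 * rhoE a) - 1)
      + (G.γ - 1) * (a 0 / w 0 - 1) - (G.physEntropy w - G.physEntropy a) := by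
    have := mul_le_mul_of_nonneg_left l2 hg.le
    rw [hsa, hsw]; linarith
  have hsq : 0 ≤ ((w 1 / w 0 - a 1 / a 0) ^ 2 + (w 2 / w 0 - a 2 / a 0) ^ 2)
      * a 0 / (2 * rhoE a) := by positivity
  have hfin : G.entropy w + a 0 - G.entropyVar a ⬝ᵥ w = w 0 / (G.γ - 1) *
      (((rhoE w * a 0 / (w 0 * rhoE a) - 1)
      + (G.γ - 1) * (a 0 / w 0 - 1) - (G.physEntropy w - G.physEntropy a)) +
        ((w 1 / w 0 - a 1 / a 0) ^ 2 + (w 2 / w 0 - a 2 / a 0) ^ 2)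
      * a 0 / (2 * rhoE a)) := by
    simp only [dotProduct, Fin.sum_univ_four, entropyVar, entropy, velocity, specificEnergy,
      Pi.smul_apply, smul_eq_mul, Matrix.cons_val]
    rw [hE, hF]
    generalize rhoE a = r at *
    generalize rhoE w = r' at *
    generalize G.physEntropy a = s at *
    generalize G.physEntropy w = s' at *
    field_simp
    ring
  have : 0 ≤ w 0 / (G.γ - 1) := by positivity
  have := mul_nonneg this (add_nonneg key hsq)
  rw [← hfin] at this
  linarith

/-- The relative entropy of `w` with respect to `a`: the distance from the tangent plane of the
entropy at `a` up to its graph, at `w`. -/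
noncomputable def Gas.relEntropy (G : Gas) (a w : State) : ℝ :=
  G.entropy w - G.entropy a - G.entropyVar a ⬝ᵥ (w - a)

/-- Vacuum is included: there the entropy vanishes, while the tangent plane has the value
`-ρ(a) < 0`. -/
theorem Gas.relEntropy_nonneg (G : Gas) {a w : State} (ha : a ∈ admissible)
    (hw : w ∈ admissible ∨ w = 0) : 0 ≤ G.relEntropy a w := by
  have h := G.entropyVar_dotProduct_self ha
  rw [relEntropy, dotProduct_sub, h]
  rcases hw with hw | rfl
  · linarith [G.entropyVar_dotProduct_le ha hw]
  · have : G.entropy 0 = 0 := by simp [entropy]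
    rw [this, dotProduct_zero]
    linarith [ha.1]

/-! ### Lax-Friedrichs fluxes and the Riemann problem -/

/-- The integrated form of `(g - ξ h)' + h ≤ 0` over `[-Λ, Λ]`, for a density `h ≥ 0` and a flux
`g` that are constant on either side of this interval. The part of `∫ h` inside the interval is
dropped. -/
theorem flux_jump_le_of_weak_ineq {g h : ℝ → ℝ} {gL gR hL hR Λ : ℝ} (hΛ : 0 < Λ)
    (hh : LocallyIntegrable h) (hg : LocallyIntegrable g)
    (h_nonneg : ∀ ξ, 0 ≤ h ξ)
    (h_left : ∀ ξ, ξ < -Λ → h ξ = hL) (h_right : ∀ ξ, Λ < ξ → h ξ = hR)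
    (g_left : ∀ ξ, ξ < -Λ → g ξ = gL) (g_right : ∀ ξ, Λ < ξ → g ξ = gR)
    (ineq : ∀ φ : ℝ → ℝ, ContDiff ℝ (⊤ : ℕ∞) φ → HasCompactSupport φ → (∀ ξ, 0 ≤ φ ξ) →
      ∫ ξ, φ ξ * h ξ ≤ ∫ ξ, deriv φ ξ * (g ξ - ξ * h ξ)) :
    gR - gL ≤ Λ * (hL + hR) := by
  -- The test function equals one on the wave fan, so that `deriv b` only sees the constant states.
  let b : ContDiffBump (0 : ℝ) := ⟨Λ, Λ + 1, hΛ, by linarith⟩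
  have hc : ContDiff ℝ (⊤ : ℕ∞) b := b.contDiff
  have hs : HasCompactSupport b := b.hasCompactSupport
  have one : ∀ ξ ∈ Icc (-Λ) Λ, b ξ = 1 := fun ξ hξ =>
    b.one_of_mem_closedBall (by simpa [b, Real.closedBall_eq_Icc] using hξ)
  have dcont : Continuous (deriv b) := hc.continuous_deriv (by simp)
  have dsupp : HasCompactSupport (deriv b) := hs.deriv
  have dzero : ∀ ξ ∈ Ioo (-Λ) Λ, deriv b ξ = 0 := fun ξ hξ => by
    have : b =ᶠ[nhds ξ] fun _ => (1 : ℝ) := by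
      filter_upwards [Ioo_mem_nhds hξ.1 hξ.2] with y hy using one y (Ioo_subset_Icc_self hy)
    rw [this.deriv_eq, deriv_const]
  have hmul : ∀ x, deriv (fun ξ => ξ * b ξ) x = b x + x * deriv b x := fun x => by
    have := (hasDerivAt_id x).mul (hc.differentiable (by simp) x).hasDerivAt
    simpa using! this.deriv
  have hc1 : ContDiff ℝ 1 b := b.contDiff
  have hcm : ContDiff ℝ 1 (fun ξ : ℝ => ξ * b ξ) := contDiff_id.mul hc1
  have hsm : HasCompactSupport (fun ξ : ℝ => ξ * b ξ) := hs.mul_left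
  have i1 : Integrable fun ξ => b ξ * h ξ :=
    hh.integrable_smul_left_of_hasCompactSupport hc.continuous hs
  have i2 : Integrable fun ξ => deriv b ξ * (g ξ - ξ * h ξ) := by
    have e1 : Integrable fun ξ => deriv b ξ * g ξ :=
      hg.integrable_smul_left_of_hasCompactSupport dcont dsupp
    have e2 : Integrable fun ξ => (deriv b ξ * ξ) * h ξ :=
      hh.integrable_smul_left_of_hasCompactSupport (dcont.mul continuous_id) dsupp.mul_right
    refine (e1.sub e2).congr (.of_forall fun ξ => ?_)
    simp only [Pi.sub_apply]; ring
  -- The constant states turn the integrand into a derivative of compactly supported functions.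
  let tail : ℝ → ℝ → ℝ → ℝ := fun y z ξ => y * deriv b ξ - z * deriv (fun ξ => ξ * b ξ) ξ
  have j1 : Integrable (deriv b) := dcont.integrable_of_hasCompactSupport dsupp
  have j2 : Integrable (deriv fun ξ => ξ * b ξ) :=
    (hcm.continuous_deriv le_rfl).integrable_of_hasCompactSupport hsm.deriv
  have jt : ∀ y z, Integrable (tail y z) := fun y z => (j1.const_mul y).sub (j2.const_mul z)
  have bl : b (-Λ) = 1 := one _ ⟨le_rfl, by linarith⟩
  have br : b Λ = 1 := one _ ⟨by linarith, le_rfl⟩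
  have tl : ∫ ξ in Iic (-Λ), tail gL hL ξ = gL + Λ * hL := by
    rw [integral_sub (j1.const_mul _).integrableOn (j2.const_mul _).integrableOn,
      integral_const_mul, integral_const_mul, HasCompactSupport.integral_Iic_deriv_eq hc1 hs,
      HasCompactSupport.integral_Iic_deriv_eq hcm hsm, bl]
    ring
  have tr : ∫ ξ in Ioi Λ, tail gR hR ξ = -gR + Λ * hR := by
    rw [integral_sub (j1.const_mul _).integrableOn (j2.const_mul _).integrableOn,
      integral_const_mul, integral_const_mul, HasCompactSupport.integral_Ioi_deriv_eq hc1 hs,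
      HasCompactSupport.integral_Ioi_deriv_eq hcm hsm, br]
    ring
  have hle := sub_nonneg.2 (ineq b hc hs fun ξ => b.nonneg)
  rw [← integral_sub i2 i1] at hle
  have hmono : ∫ ξ, (deriv b ξ * (g ξ - ξ * h ξ) - b ξ * h ξ) ≤
      ∫ ξ, ((Iic (-Λ)).indicator (tail gL hL) ξ + (Ioi Λ).indicator (tail gR hR) ξ) := by
    refine integral_mono_ae (i2.sub i1) (((jt _ _).indicator measurableSet_Iic).add
      ((jt _ _).indicator measurableSet_Ioi)) ?_
    -- Nothing is known about `g` and `h` at the two points `±Λ`, which are negligible.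
    filter_upwards [compl_mem_ae_iff.2 (measure_singleton (-Λ)),
      compl_mem_ae_iff.2 (measure_singleton Λ)] with ξ h1 h2
    rcases lt_or_gt_of_ne h1 with h1 | h1
    · rw [indicator_of_mem (by exact h1.le), indicator_of_notMem (by
        simp only [mem_Ioi, not_lt]; linarith)]
      simp only [tail, hmul, h_left ξ h1, g_left ξ h1]
      exact le_of_eq (by ring)
    rw [indicator_of_notMem (by simpa using h1)]
    rcases lt_or_gt_of_ne h2 with h2 | h2
    · rw [indicator_of_notMem (by simpa using h2.le), dzero ξ ⟨h1, h2⟩,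
        one ξ ⟨h1.le, h2.le⟩]
      have := h_nonneg ξ
      linarith
    · rw [indicator_of_mem (by exact h2)]
      simp only [tail, hmul, h_right ξ h2, g_right ξ h2]
      exact le_of_eq (by ring)
  rw [integral_add ((jt _ _).indicator measurableSet_Iic) ((jt _ _).indicator measurableSet_Ioi),
    integral_indicator measurableSet_Iic, integral_indicator measurableSet_Ioi, tl, tr] at hmono
  linarith

/-- Integration by parts; it says that constants satisfy the self-similar conservation law
`(-ξ c)' + c = 0`. -/
theorem integral_eq_neg_integral_deriv_mul_self {b : ℝ → ℝ} (hb : ContDiff ℝ 1 b)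
    (hs : HasCompactSupport b) : ∫ ξ, b ξ = -∫ ξ, deriv b ξ * ξ := by
  have dcont : Continuous (deriv b) := hb.continuous_deriv le_rfl
  have i1 : Integrable b := hb.continuous.integrable_of_hasCompactSupport hs
  have i2 : Integrable fun ξ => deriv b ξ * ξ :=
    (dcont.mul continuous_id).integrable_of_hasCompactSupport hs.deriv.mul_right
  have h0 : ∫ ξ, (deriv b ξ * ξ + b ξ * 1) = 0 :=
    integral_eq_zero_of_hasDerivAt_of_integrable
      (fun ξ => (hb.differentiable one_ne_zero ξ).hasDerivAt.mul (hasDerivAt_id ξ))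
      (by simpa using! i2.add i1)
      ((hb.continuous.mul continuous_id).integrable_of_hasCompactSupport hs.mul_right)
  simp only [mul_one] at h0
  rw [integral_add i2 i1] at h0
  linarith

theorem Gas.relEntropy_self (G : Gas) (a : State) : G.relEntropy a a = 0 := by
  simp [relEntropy]

/-- The relative entropy with respect to a fixed state `a` satisfies an entropy inequality along a
Riemann solution, because it differs from `η` by an affine function of the conserved variables.
Integrating over the wave fan leaves a relation between the outer states. -/
theorem Gas.entropyFlux_sub_le (G : Gas) {n : Fin 2 → ℝ} {uL uR a : State} {lam Λ : ℝ}
    {U : ℝ → State} (ha : a ∈ admissible) (hU : G.IsRiemannSolution n uL uR lam U)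
    (hΛ : 0 < Λ) (hle : lam ≤ Λ) :
    G.entropyFlux n uR - G.entropyFlux n uL
        - G.entropyVar a ⬝ᵥ (G.normalFlux n uR - G.normalFlux n uL) ≤
      Λ * (G.relEntropy a uL + G.relEntropy a uR) := by
  let ℓ : State →L[ℝ] ℝ := LinearMap.toContinuousLinearMap
    { toFun := fun w => G.entropyVar a ⬝ᵥ w
      map_add' := fun x y => dotProduct_add _ x y
      map_smul' := fun c x => dotProduct_smul c _ x }
  have hℓ : ∀ w, ℓ w = G.entropyVar a ⬝ᵥ w := fun _ => rfl
  have left : ∀ ξ, ξ < -Λ → U ξ = uL := fun ξ h => hU.left ξ (by linarith)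
  have right : ∀ ξ, Λ < ξ → U ξ = uR := fun ξ h => hU.right ξ (by linarith)
  have comp : ∀ {F : ℝ → State}, LocallyIntegrable F → LocallyIntegrable fun ξ => ℓ (F ξ) :=
    fun hF x => by
      obtain ⟨s, hs, hi⟩ := hF x
      exact ⟨s, hs, ℓ.integrable_comp hi⟩
  have hη := hU.integrable_entropy
  have hq := hU.integrable_entropyFlux
  have hu := comp hU.integrable_state
  have hf := comp hU.integrable_flux
  let c := G.entropy a - ℓ a
  have hrel : ∀ w, G.relEntropy a w = G.entropy w - ℓ w - c := fun w => by
    simp only [relEntropy, c, ← hℓ, map_sub]; ring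
  have key := flux_jump_le_of_weak_ineq (h := fun ξ => G.relEntropy a (U ξ))
    (g := fun ξ => G.entropyFlux n (U ξ) - ℓ (G.normalFlux n (U ξ)))
    (gL := G.entropyFlux n uL - ℓ (G.normalFlux n uL))
    (gR := G.entropyFlux n uR - ℓ (G.normalFlux n uR))
    (hL := G.relEntropy a uL) (hR := G.relEntropy a uR) hΛ
    (by simp only [hrel]; exact (hη.sub hu).sub (locallyIntegrable_const c)) (hq.sub hf)
    (fun ξ => G.relEntropy_nonneg ha (hU.mem ξ))
    (fun ξ h => by simp only [left ξ h]) (fun ξ h => by simp only [right ξ h])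
    (fun ξ h => by simp only [left ξ h]) (fun ξ h => by simp only [right ξ h]) ?_
  · rw [← hℓ, map_sub]; linarith
  intro φ hc hs hn
  have hc1 : ContDiff ℝ 1 φ := hc.of_le (by exact_mod_cast le_top)
  have dcont : Continuous (deriv φ) := hc1.continuous_deriv le_rfl
  have ds := hs.deriv
  have ic : ∀ {F : ℝ → ℝ}, LocallyIntegrable F → Integrable fun ξ => φ ξ * F ξ :=
    fun hF => hF.integrable_smul_left_of_hasCompactSupport hc.continuous hs
  have id1 : ∀ {F : ℝ → ℝ}, LocallyIntegrable F → Integrable fun ξ => deriv φ ξ * F ξ :=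
    fun hF => hF.integrable_smul_left_of_hasCompactSupport dcont ds
  have id2 : ∀ {F : ℝ → ℝ}, LocallyIntegrable F → Integrable fun ξ => deriv φ ξ * ξ * F ξ :=
    fun hF => hF.integrable_smul_left_of_hasCompactSupport (dcont.mul continuous_id) ds.mul_right
  have e := hU.entropy_ineq φ hc hs hn
  have w : ∫ ξ, (deriv φ ξ * ℓ (G.normalFlux n (U ξ)) - deriv φ ξ * ξ * ℓ (U ξ))
      = ∫ ξ, φ ξ * ℓ (U ξ) := by
    have h1 : Integrable fun ξ => deriv φ ξ • (G.normalFlux n (U ξ) - ξ • U ξ) := by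
      have e1 : Integrable fun ξ => deriv φ ξ • G.normalFlux n (U ξ) :=
        hU.integrable_flux.integrable_smul_left_of_hasCompactSupport dcont ds
      have e2 : Integrable fun ξ => (deriv φ ξ * ξ) • U ξ :=
        hU.integrable_state.integrable_smul_left_of_hasCompactSupport
          (dcont.mul continuous_id) ds.mul_right
      refine (e1.sub e2).congr (.of_forall fun ξ => ?_)
      simp only [Pi.sub_apply, smul_sub, smul_smul]
    have h2 : Integrable fun ξ => φ ξ • U ξ :=
      hU.integrable_state.integrable_smul_left_of_hasCompactSupport hc.continuous hs
    have h3 := congrArg ℓ (hU.weak φ hc hs)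
    rw [← ℓ.integral_comp_comm h1, ← ℓ.integral_comp_comm h2] at h3
    simp only [map_smul, map_sub, smul_eq_mul] at h3
    rw [← h3]
    congr 1; ext ξ; ring
  have hone := integral_eq_neg_integral_deriv_mul_self hc1 hs
  have iφ : Integrable φ := hc.continuous.integrable_of_hasCompactSupport hs
  have iφ' : Integrable fun ξ => deriv φ ξ * ξ :=
    (dcont.mul continuous_id).integrable_of_hasCompactSupport ds.mul_right
  have lhs : ∫ ξ, φ ξ * G.relEntropy a (U ξ)
      = (∫ ξ, φ ξ * G.entropy (U ξ)) - (∫ ξ, φ ξ * ℓ (U ξ)) - c * ∫ ξ, φ ξ := by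
    have i1 : Integrable fun ξ => φ ξ * G.entropy (U ξ) - φ ξ * ℓ (U ξ) := (ic hη).sub (ic hu)
    rw [← integral_const_mul, ← integral_sub (ic hη) (ic hu), ← integral_sub i1 (iφ.const_mul c)]
    congr 1; ext ξ; rw [hrel]; ring
  have ie : Integrable fun ξ => deriv φ ξ * (G.entropyFlux n (U ξ) - ξ * G.entropy (U ξ)) := by
    refine ((id1 hq).sub (id2 hη)).congr (.of_forall fun ξ => ?_)
    simp only [Pi.sub_apply]; ring
  have iw : Integrable fun ξ => deriv φ ξ * ℓ (G.normalFlux n (U ξ)) - deriv φ ξ * ξ * ℓ (U ξ) :=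
    (id1 hf).sub (id2 hu)
  have rhs : ∫ ξ, deriv φ ξ * (G.entropyFlux n (U ξ) - ℓ (G.normalFlux n (U ξ))
        - ξ * G.relEntropy a (U ξ))
      = (∫ ξ, deriv φ ξ * (G.entropyFlux n (U ξ) - ξ * G.entropy (U ξ)))
        - (∫ ξ, (deriv φ ξ * ℓ (G.normalFlux n (U ξ)) - deriv φ ξ * ξ * ℓ (U ξ)))
        + c * ∫ ξ, deriv φ ξ * ξ := by
    have i1 : Integrable fun ξ => deriv φ ξ * (G.entropyFlux n (U ξ) - ξ * G.entropy (U ξ))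
        - (deriv φ ξ * ℓ (G.normalFlux n (U ξ)) - deriv φ ξ * ξ * ℓ (U ξ)) := ie.sub iw
    rw [← integral_const_mul, ← integral_sub ie iw, ← integral_add i1 (iφ'.const_mul c)]
    congr 1; ext ξ; rw [hrel]; ring
  rw [lhs, rhs, w, hone]
  linarith

/-- Tadmor's condition for the local Lax-Friedrichs flux, times two. It is the sum of the relative
entropy inequalities of the Riemann solution with respect to `uL` and to `uR`. -/
theorem Gas.dotProduct_laxFriedrichs_le (G : Gas) {n : Fin 2 → ℝ} {uL uR : State} {lam Λ : ℝ}
    {U : ℝ → State} (hL : uL ∈ admissible) (hR : uR ∈ admissible) (hU : G.IsRiemannSolution n uL uR lam U)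
    (hΛ : 0 < Λ) (hle : lam ≤ Λ) :
    (G.entropyVar uR - G.entropyVar uL) ⬝ᵥ
      (∑ k, n k • (G.flux k uL + G.flux k uR) - Λ • (uR - uL)) ≤
      2 * ∑ k, n k * (G.entropyPotential k uR - G.entropyPotential k uL) := by
  have h1 := G.entropyFlux_sub_le hL hU hΛ hle
  have h2 := G.entropyFlux_sub_le hR hU hΛ hle
  rw [relEntropy_self] at h1 h2
  have hq : ∀ u, ∑ k, n k * G.entropyPotential k u
      = G.entropyVar u ⬝ᵥ G.normalFlux n u - G.entropyFlux n u := fun u => by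
    have hn : n ⬝ᵥ velocity u = n 0 * velocity u 0 + n 1 * velocity u 1 := by
      simp only [dotProduct, Fin.sum_univ_two]
    simp only [normalFlux, entropyFlux, entropyPotential, hn, Fin.sum_univ_two, dotProduct_add,
      dotProduct_smul, smul_eq_mul]
    ring
  have hf : ∑ k, n k • (G.flux k uL + G.flux k uR) = G.normalFlux n uL + G.normalFlux n uR := by
    simp only [normalFlux, smul_add, Finset.sum_add_distrib]
  simp only [mul_sub, Finset.sum_sub_distrib, hq, hf]
  simp only [relEntropy, sub_dotProduct, dotProduct_sub, dotProduct_add, dotProduct_smul,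
    smul_eq_mul] at h1 h2 ⊢
  linarith

/-! ### Symmetry and size of the dissipation coefficients -/

theorem norm2_neg (n : Fin 2 → ℝ) : norm2 (-n) = norm2 n := by simp [norm2]

theorem eq_zero_of_norm2_eq_zero {n : Fin 2 → ℝ} (h : norm2 n = 0) : n = 0 := by
  rw [norm2, Real.sqrt_eq_zero (by positivity)] at h
  have h0 : n 0 = 0 := pow_eq_zero_iff two_ne_zero |>.1 (by
    nlinarith [sq_nonneg (n 0), sq_nonneg (n 1)])
  have h1 : n 1 = 0 := pow_eq_zero_iff two_ne_zero |>.1 (by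
    nlinarith [sq_nonneg (n 0), sq_nonneg (n 1)])
  ext k; fin_cases k <;> simp [h0, h1]

theorem norm2_smul (c : ℝ) (n : Fin 2 → ℝ) : norm2 (c • n) = |c| * norm2 n := by
  rw [norm2, norm2, ← Real.sqrt_sq_eq_abs, ← Real.sqrt_mul (sq_nonneg c)]
  congr 1; simp only [Pi.smul_apply, smul_eq_mul]; ring

theorem norm2_normalize {n : Fin 2 → ℝ} (h : norm2 n ≠ 0) : norm2 (normalize n) = 1 := by
  have h0 : 0 ≤ norm2 n := Real.sqrt_nonneg _
  rw [normalize, norm2_smul, abs_of_nonneg (inv_nonneg.2 h0), inv_mul_cancel₀ h]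

theorem normalize_neg (n : Fin 2 → ℝ) : normalize (-n) = -normalize n := by
  simp [normalize, norm2_neg]

/-- The interface penalization uses `|n₀| + |n₁|` in place of `|n| = 1`, which only adds
dissipation. -/
theorem one_le_sum_abs_of_norm2_eq_one {n : Fin 2 → ℝ} (h : norm2 n = 1) : 1 ≤ ∑ k, |n k| := by
  rw [norm2, Real.sqrt_eq_one] at h
  rw [Fin.sum_univ_two]
  nlinarith [sq_abs (n 0), sq_abs (n 1), abs_nonneg (n 0), abs_nonneg (n 1),
    mul_nonneg (abs_nonneg (n 0)) (abs_nonneg (n 1))]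

namespace Gas

variable (G : Gas)

theorem zhangBeta_neg (ε₀ : ℝ) (u : State) (σ : Fin 2 → State) (n : Fin 2 → ℝ) :
    G.zhangBeta ε₀ u σ (-n) = G.zhangBeta ε₀ u σ n := by
  have h : (fun k => (-n) 0 * σ k 1 + (-n) 1 * σ k 2) - G.pressure u • (-n)
      = -((fun k => n 0 * σ k 1 + n 1 * σ k 2) - G.pressure u • n) := by
    ext k; simp only [Pi.sub_apply, Pi.neg_apply, Pi.smul_apply, smul_eq_mul]; ring
  simp only [zhangBeta]
  rw [h, norm2_neg, dotProduct_neg, neg_dotProduct, abs_neg, abs_neg, neg_sq]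

theorem zhangBeta_pos {ε₀ : ℝ} (hε : 0 < ε₀) {u : State} (hu : u ∈ admissible)
    (σ : Fin 2 → State) (n : Fin 2 → ℝ) : 0 < G.zhangBeta ε₀ u σ n := by
  obtain ⟨h0, h1⟩ := hu
  have he : 0 < specificEnergy u := div_pos h1 h0
  simp only [zhangBeta]
  positivity

theorem dissipation_pos {ε₀ : ℝ} (hε : 0 < ε₀) (lamMax : State → State → (Fin 2 → ℝ) → ℝ)
    {uL uR : State} (hL : uL ∈ admissible) (σL σR : Fin 2 → State) (n : Fin 2 → ℝ) :
    0 < G.dissipation ε₀ lamMax uL uR σL σR n :=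
  lt_max_of_lt_right (lt_max_of_lt_left (G.zhangBeta_pos hε hL σL n))

variable {G} in
theorem IsWaveSpeedBound.dissipation_symm {lamMax : State → State → (Fin 2 → ℝ) → ℝ}
    (h : G.IsWaveSpeedBound lamMax) (ε₀ : ℝ) {uL uR : State} (hL : uL ∈ admissible)
    (hR : uR ∈ admissible) (σL σR : Fin 2 → State) {n : Fin 2 → ℝ} (hn : norm2 n = 1) :
    G.dissipation ε₀ lamMax uR uL σR σL (-n) = G.dissipation ε₀ lamMax uL uR σL σR n := by
  simp only [dissipation, zhangBeta_neg, h.symm uL hL uR hR n hn]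
  rw [max_comm (G.zhangBeta ε₀ uR σR n)]

variable {G} in
theorem IsWaveSpeedBound.entropy_dissipative {lamMax : State → State → (Fin 2 → ℝ) → ℝ}
    (h : G.IsWaveSpeedBound lamMax) {ε₀ : ℝ} (hε : 0 < ε₀) {uL uR : State}
    (hL : uL ∈ admissible) (hR : uR ∈ admissible) (σL σR : Fin 2 → State) {n : Fin 2 → ℝ}
    (hn : norm2 n = 1) {Λ : ℝ} (hΛ : G.dissipation ε₀ lamMax uL uR σL σR n ≤ Λ) :
    (G.entropyVar uR - G.entropyVar uL) ⬝ᵥ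
      (∑ k, n k • (G.flux k uL + G.flux k uR) - Λ • (uR - uL)) ≤
      2 * ∑ k, n k * (G.entropyPotential k uR - G.entropyPotential k uL) := by
  obtain ⟨U, hU⟩ := h.bound uL hL uR hR n hn
  exact G.dotProduct_laxFriedrichs_le hL hR hU
    ((G.dissipation_pos hε lamMax hL σL σR n).trans_le hΛ)
    ((le_max_left _ _).trans hΛ)

end Gas

/-! ### Summation by parts on one element -/

section Sums

theorem eq_zero_of_eq_neg_self {V : Type*} [AddCommGroup V] [Module ℝ V] {x : V} (h : x = -x) :
    x = 0 := by
  have h2 : (2 : ℝ) • x = 0 := by rw [two_smul, ← sub_neg_eq_add, ← h, sub_self]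
  exact (smul_eq_zero_iff_right two_ne_zero).1 h2

variable {ι φ : Type*} [Fintype ι] [Fintype φ]

theorem sum_sum_eq_zero_of_antisymm {V : Type*} [AddCommGroup V] [Module ℝ V] {X : ι → ι → V}
    (hX : ∀ i j, X j i = -X i j) : ∑ i, ∑ j, X i j = 0 := by
  have h : ∑ i, ∑ j, X i j = -∑ i, ∑ j, X i j := by
    conv_lhs => rw [Finset.sum_comm]
    simp only [← Finset.sum_neg_distrib, ← hX]
  exact eq_zero_of_eq_neg_self h

theorem sum_sum_dotProduct_of_antisymm {v : ι → State} {X : ι → ι → State}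
    (hX : ∀ i j, X j i = -X i j) :
    ∑ i, ∑ j, v i ⬝ᵥ X i j = -((∑ i, ∑ j, (v j - v i) ⬝ᵥ X i j) / 2) := by
  have h : ∑ i, ∑ j, v j ⬝ᵥ X i j = -∑ i, ∑ j, v i ⬝ᵥ X i j := by
    rw [Finset.sum_comm]
    simp only [← Finset.sum_neg_distrib, ← dotProduct_neg, ← hX]
  simp only [sub_dotProduct, Finset.sum_sub_distrib]
  linarith

variable [DecidableEq ι]

/-- The row sums of the skew-symmetric part of a summation-by-parts matrix are boundary terms. -/
theorem sum_skew_of_sbp [DecidableEq φ] {Q : Matrix ι ι ℝ} {node : φ → ι} {b : φ → ℝ}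
    (h : Q + Qᵀ = (extraction node)ᵀ * Matrix.diagonal b * extraction node) (h1 : Q *ᵥ 1 = 0)
    (i : ι) : ∑ j, (Q i j - Q j i) / 2 = -((∑ f with node f = i, b f) / 2) := by
  have hr : ∑ j, Q i j = 0 := by simpa [Matrix.mulVec, dotProduct] using congrFun h1 i
  have hc : ∑ j, Q j i = ∑ f with node f = i, b f := by
    have : ∀ j, Q j i = (∑ f, if node f = i then (if node f = j then b f else 0) else 0) - Q i j := by
      intro j
      have := congrFun (congrFun h i) j
      simp only [Matrix.add_apply, Matrix.transpose_apply, Matrix.mul_apply (M := _ * _),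
        extraction, Matrix.mul_diagonal, Matrix.of_apply, ite_mul, one_mul, zero_mul, mul_ite, mul_one,
        mul_zero] at this
      rw [eq_sub_iff_add_eq, add_comm, this]
      exact Finset.sum_congr rfl fun f _ => by split_ifs <;> rfl
    simp only [this, Finset.sum_sub_distrib, hr, sub_zero]
    rw [Finset.sum_comm, Finset.sum_filter]
    refine Finset.sum_congr rfl fun f _ => ?_
    split_ifs <;> simp
  rw [← Finset.sum_div, Finset.sum_sub_distrib, hr, hc]
  ring

theorem sum_sum_filter_node {V : Type*} [AddCommMonoid V] (node : φ → ι) (g : φ → V) :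
    ∑ i, ∑ f with node f = i, g f = ∑ f, g f :=
  Finset.sum_fiberwise _ _ _

theorem sum_mul_sum_filter_node (node : φ → ι) (a : ι → ℝ) (g : φ → ℝ) :
    ∑ i, a i * ∑ f with node f = i, g f = ∑ f, g f * a (node f) := by
  rw [← sum_sum_filter_node node fun f => g f * a (node f)]
  refine Finset.sum_congr rfl fun i _ => ?_
  rw [Finset.mul_sum]
  refine Finset.sum_congr rfl fun f hf => ?_
  rw [(Finset.mem_filter.1 hf).2, mul_comm]

variable {node : φ → ι} {b : φ → ℝ} {A : ι → ι → ℝ}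

theorem sum_sum_skew_mul
    (hrow : ∀ i, ∑ j, A i j = -((∑ f with node f = i, b f) / 2)) (ψ : ι → ℝ) :
    ∑ i, ∑ j, A i j * ψ i = -((∑ f, b f * ψ (node f)) / 2) := by
  rw [← sum_mul_sum_filter_node, Finset.sum_div, ← Finset.sum_neg_distrib]
  refine Finset.sum_congr rfl fun i _ => ?_
  rw [← Finset.sum_mul, hrow]
  ring

theorem sum_sum_skew_mul_sub (hA : ∀ i j, A j i = -A i j)
    (hrow : ∀ i, ∑ j, A i j = -((∑ f with node f = i, b f) / 2)) (ψ : ι → ℝ) :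
    ∑ i, ∑ j, A i j * (ψ j - ψ i) = ∑ f, b f * ψ (node f) := by
  have h : ∑ i, ∑ j, A i j * ψ j = -∑ i, ∑ j, A i j * ψ i := by
    rw [Finset.sum_comm]
    simp only [← Finset.sum_neg_distrib, ← neg_mul, ← hA]
  simp only [mul_sub, Finset.sum_sub_distrib, h, sum_sum_skew_mul hrow]
  ring

/-- Summation by parts for the viscous fluxes: the skew-symmetric operator is moved from `s` to
`v`. -/
theorem sum_sum_skew_mul_dotProduct_add (hA : ∀ i j, A j i = -A i j)
    (hrow : ∀ i, ∑ j, A i j = -((∑ f with node f = i, b f) / 2)) (v s : ι → State) :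
    ∑ i, ∑ j, A i j * (v i ⬝ᵥ (s i + s j)) =
      -((∑ f, b f * (v (node f) ⬝ᵥ s (node f))) / 2) - ∑ i, s i ⬝ᵥ ∑ j, A i j • v j := by
  have h : ∑ i, ∑ j, A i j * (v i ⬝ᵥ s j) = -∑ i, s i ⬝ᵥ ∑ j, A i j • v j := by
    rw [Finset.sum_comm]
    simp only [← Finset.sum_neg_distrib, dotProduct_sum, dotProduct_smul, smul_eq_mul, ← neg_mul,
      ← hA]
    exact Finset.sum_congr rfl fun i _ => Finset.sum_congr rfl fun j _ => by
      rw [dotProduct_comm]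
  simp only [dotProduct_add, mul_add, Finset.sum_add_distrib, h]
  rw [sum_sum_skew_mul hrow (fun i => v i ⬝ᵥ s i)]
  ring

/-- Testing the volume terms of a residual with the entropy variables. If the skew-symmetric
volume flux `X` satisfies the entropy dissipation condition `hent`, then its contribution is bounded
below by the boundary values of the entropy potential `ψ`, and the viscous fluxes `σ` are paired with
the volume part of the discrete gradient of `v`. -/
theorem le_sum_dotProduct_volume {b : Fin 2 → φ → ℝ}
    {A : Fin 2 → ι → ι → ℝ} (hA : ∀ k i j, A k j i = -A k i j)
    (hrow : ∀ k i, ∑ j, A k i j = -((∑ f with node f = i, b k f) / 2)) {v : ι → State}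
    (σ : Fin 2 → ι → State) {ψ : Fin 2 → ι → ℝ} {X : ι → ι → State}
    (hX : ∀ i j, X j i = -X i j)
    (hent : ∀ i j, (v j - v i) ⬝ᵥ X i j ≤ 2 * ∑ k, A k i j * (ψ k j - ψ k i)) :
    ∑ k, (∑ f, b k f * (v (node f) ⬝ᵥ σ k (node f)) / 2 - ∑ f, b k f * ψ k (node f)
        + ∑ i, σ k i ⬝ᵥ ∑ j, A k i j • v j)
      ≤ ∑ i, v i ⬝ᵥ ∑ j, (X i j - ∑ k, A k i j • (σ k i + σ k j)) := by
  have swap : ∀ g : Fin 2 → ι → ι → ℝ, ∑ i, ∑ j, ∑ k, g k i j = ∑ k, ∑ i, ∑ j, g k i j :=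
    fun g => by simp only [Fin.sum_univ_two, Finset.sum_add_distrib]
  have h0 : ∑ i, v i ⬝ᵥ ∑ j, (X i j - ∑ k, A k i j • (σ k i + σ k j))
      = ∑ i, ∑ j, v i ⬝ᵥ X i j - ∑ k, ∑ i, ∑ j, A k i j * (v i ⬝ᵥ (σ k i + σ k j)) := by
    rw [← swap]
    simp only [← smul_eq_mul, ← dotProduct_smul, ← dotProduct_sum, ← dotProduct_sub,
      ← Finset.sum_sub_distrib]
  have h1 : ∑ i, ∑ j, (v j - v i) ⬝ᵥ X i j ≤ 2 * ∑ k, ∑ f, b k f * ψ k (node f) := by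
    refine (Finset.sum_le_sum fun i _ => Finset.sum_le_sum fun j _ => hent i j).trans_eq ?_
    simp only [← sum_sum_skew_mul_sub (hA _) (hrow _), ← Finset.mul_sum, swap]
  have h2 := sum_sum_dotProduct_of_antisymm (v := v) hX
  rw [h0, h2]
  simp only [sum_sum_skew_mul_dotProduct_add (hA _) (hrow _), Finset.sum_add_distrib,
    Finset.sum_sub_distrib, Finset.sum_neg_distrib, ← Finset.sum_div]
  linarith

end Sums

variable {κ ι φ : Type*} [Fintype ι] [DecidableEq ι] [Fintype φ] [DecidableEq φ]

/-! ### Interfaces of a periodic mesh -/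

namespace PeriodicMesh

variable (T : PeriodicMesh κ ι φ)

theorem sum_faces_nbr [Fintype κ] {V : Type*} [AddCommMonoid V] (X : κ → φ → V) :
    ∑ e, ∑ f, X (T.nbr (e, f)).1 (T.nbr (e, f)).2 = ∑ e, ∑ f, X e f := by
  rw [← Fintype.sum_prod_type', ← Fintype.sum_prod_type']
  exact Equiv.sum_comp (Function.Involutive.toPerm T.nbr T.nbr_nbr) fun x => X x.1 x.2

theorem sum_faces_eq_zero [Fintype κ] {V : Type*} [AddCommGroup V] [Module ℝ V] {X : κ → φ → V}
    (hX : ∀ e f, X (T.nbr (e, f)).1 (T.nbr (e, f)).2 = -X e f) : ∑ e, ∑ f, X e f = 0 := by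
  refine eq_zero_of_eq_neg_self ?_
  conv_lhs => rw [← T.sum_faces_nbr]
  simp only [hX, Finset.sum_neg_distrib]

theorem inner_nbr {X : Type*} (a : κ → ι → X) (e : κ) (f : φ) :
    T.inner a (T.nbr (e, f)).1 (T.nbr (e, f)).2 = T.outer a e f := rfl

theorem outer_nbr {X : Type*} (a : κ → ι → X) (e : κ) (f : φ) :
    T.outer a (T.nbr (e, f)).1 (T.nbr (e, f)).2 = T.inner a e f := by
  rw [outer, Prod.mk.eta, T.nbr_nbr]

theorem B_nbr (k : Fin 2) (e : κ) (f : φ) :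
    (T.elem (T.nbr (e, f)).1).B k (T.nbr (e, f)).2 = -(T.elem e).B k f := by
  simp only [SBPElement.B, T.wf_nbr, T.normal_nbr, Pi.neg_apply, mul_neg]

theorem sum_faces_dotProduct [Fintype κ] {v : κ → ι → State} {X : κ → φ → State}
    (hX : ∀ e f, X (T.nbr (e, f)).1 (T.nbr (e, f)).2 = -X e f) :
    ∑ e, ∑ f, T.inner v e f ⬝ᵥ X e f
      = -((∑ e, ∑ f, (T.outer v e f - T.inner v e f) ⬝ᵥ X e f) / 2) := by
  have h := T.sum_faces_nbr fun e f => T.inner v e f ⬝ᵥ X e f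
  simp only [inner_nbr, hX, dotProduct_neg, Finset.sum_neg_distrib] at h
  simp only [sub_dotProduct, Finset.sum_sub_distrib]
  linarith

theorem sum_faces_B_mul_outer [Fintype κ] (k : Fin 2) (ψ : κ → ι → ℝ) :
    ∑ e, ∑ f, (T.elem e).B k f * T.outer ψ e f
      = -∑ e, ∑ f, (T.elem e).B k f * T.inner ψ e f := by
  rw [← T.sum_faces_nbr fun e f => (T.elem e).B k f * T.outer ψ e f]
  simp only [B_nbr, outer_nbr, neg_mul, Finset.sum_neg_distrib]

theorem m_smul_ldgGradient (Q : κ → Fin 2 → Matrix ι ι ℝ) (v : κ → ι → State) (k : Fin 2) (e : κ)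
    (i : ι) : (T.elem e).m i • T.ldgGradient Q v k e i
      = ∑ j, ((Q e k i j - Q e k j i) / 2) • v e j
        + ∑ f with (T.elem e).faceNode f = i, ((T.elem e).B k f / 2) • T.outer v e f := by
  rw [ldgGradient, smul_smul, mul_inv_cancel₀ ((T.elem e).m_pos i).ne', one_smul]

end PeriodicMesh

namespace SBPElement

variable (D : SBPElement ι φ)

theorem sum_skew_low (k : Fin 2) (i : ι) : ∑ j, (D.QL k i j - D.QL k j i) / 2
    = -((∑ f with D.faceNode f = i, D.B k f) / 2) :=
  sum_skew_of_sbp (D.sbpL k) (D.QL_one k) i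

theorem sum_skew_high (k : Fin 2) (i : ι) : ∑ j, (D.Q k i j - D.Q k j i) / 2
    = -((∑ f with D.faceNode f = i, D.B k f) / 2) :=
  sum_skew_of_sbp (D.sbp k) (D.Q_one k) i

theorem nij_swap (i j : ι) : D.nij j i = -D.nij i j := by
  ext k; simp only [nij, Pi.neg_apply]; ring

end SBPElement

namespace Scheme

variable (S : Scheme κ ι φ) {u : κ → ι → State} (σ : Fin 2 → κ → ι → State)

theorem graphVisc_symm (hu : ∀ e i, u e i ∈ admissible) (e : κ) (i j : ι) :
    S.graphVisc u σ e j i = S.graphVisc u σ e i j := by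
  by_cases h : norm2 ((S.mesh.elem e).nij i j) = 0
  · rw [graphVisc, graphVisc, SBPElement.nij_swap, norm2_neg, h, mul_zero, mul_zero]
  · rw [graphVisc, graphVisc, SBPElement.nij_swap, norm2_neg, normalize_neg,
      S.lamMax_bound.dissipation_symm S.ε₀ (hu e i) (hu e j) _ _ (norm2_normalize h)]

theorem faceVisc_nbr (hu : ∀ e i, u e i ∈ admissible) (k : Fin 2) (e : κ) (f : φ) :
    S.faceVisc u σ k (S.mesh.nbr (e, f)).1 (S.mesh.nbr (e, f)).2 = S.faceVisc u σ k e f := by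
  simp only [faceVisc, PeriodicMesh.B_nbr, PeriodicMesh.inner_nbr, PeriodicMesh.outer_nbr,
    S.mesh.normal_nbr, abs_neg]
  rw [S.lamMax_bound.dissipation_symm (uL := S.mesh.inner u e f) (uR := S.mesh.outer u e f)
    S.ε₀ (hu _ _) (hu _ _) _ _ ((S.mesh.elem e).normal_unit f)]

/-! ### Inviscid numerical fluxes -/

/-- The inviscid part of the low order volume terms with the graph viscosity, for a pair of nodes. -/
noncomputable def lowVolumeFlux (u : κ → ι → State) (σ : Fin 2 → κ → ι → State) (e : κ) (i j : ι) :
    State :=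
  ∑ k, (S.mesh.elem e).nij i j k • (S.gas.flux k (u e i) + S.gas.flux k (u e j))
    - S.graphVisc u σ e i j • (u e j - u e i)

/-- The inviscid part of the high order volume terms, for a pair of nodes. -/
noncomputable def highVolumeFlux (u : κ → ι → State) (e : κ) (i j : ι) : State :=
  ∑ k, ((S.mesh.elem e).Q k i j - (S.mesh.elem e).Q k j i) • S.fS k (u e i) (u e j)

/-- The inviscid part of the interface terms with the penalization, at a surface point. -/
noncomputable def faceFlux (u : κ → ι → State) (σ : Fin 2 → κ → ι → State) (e : κ) (f : φ) :
    State :=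
  ∑ k, (((S.mesh.elem e).B k f / 2) •
      (S.gas.flux k (S.mesh.inner u e f) + S.gas.flux k (S.mesh.outer u e f))
    - S.faceVisc u σ k e f • (S.mesh.outer u e f - S.mesh.inner u e f))

theorem lowVolumeFlux_swap (hu : ∀ e i, u e i ∈ admissible) (e : κ) (i j : ι) :
    S.lowVolumeFlux u σ e j i = -S.lowVolumeFlux u σ e i j := by
  rw [lowVolumeFlux, lowVolumeFlux, S.graphVisc_symm σ hu, SBPElement.nij_swap]
  simp only [Pi.neg_apply, neg_smul, Finset.sum_neg_distrib, add_comm (S.gas.flux _ (u e j))]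
  module

theorem highVolumeFlux_swap (hu : ∀ e i, u e i ∈ admissible) (e : κ) (i j : ι) :
    S.highVolumeFlux u e j i = -S.highVolumeFlux u e i j := by
  rw [highVolumeFlux, highVolumeFlux, ← Finset.sum_neg_distrib]
  refine Finset.sum_congr rfl fun k _ => ?_
  rw [(S.fS_conservative k).symm _ (hu e j) _ (hu e i), ← neg_smul, neg_sub]

theorem faceFlux_nbr (hu : ∀ e i, u e i ∈ admissible) (e : κ) (f : φ) :
    S.faceFlux u σ (S.mesh.nbr (e, f)).1 (S.mesh.nbr (e, f)).2 = -S.faceFlux u σ e f := by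
  simp only [faceFlux, PeriodicMesh.B_nbr, PeriodicMesh.inner_nbr, PeriodicMesh.outer_nbr,
    S.faceVisc_nbr σ hu, ← Finset.sum_neg_distrib]
  exact Finset.sum_congr rfl fun k _ => by module

/-- Tadmor's condition in the direction `nij / |nij|`, scaled by `|nij|`; both sides vanish if
`nij = 0`. -/
theorem lowVolumeFlux_entropy (hu : ∀ e i, u e i ∈ admissible) (e : κ) (i j : ι) :
    (S.v u e j - S.v u e i) ⬝ᵥ S.lowVolumeFlux u σ e i j ≤
      2 * ∑ k, (S.mesh.elem e).nij i j k *
        (S.gas.entropyPotential k (u e j) - S.gas.entropyPotential k (u e i)) := by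
  by_cases h : norm2 ((S.mesh.elem e).nij i j) = 0
  · rw [lowVolumeFlux, graphVisc, h, eq_zero_of_norm2_eq_zero h]
    simp
  · have hpos : 0 ≤ norm2 ((S.mesh.elem e).nij i j) := Real.sqrt_nonneg _
    have key := mul_le_mul_of_nonneg_left (S.lamMax_bound.entropy_dissipative S.ε₀_pos (hu e i)
      (hu e j) (fun k => σ k e i) (fun k => σ k e j) (norm2_normalize h) le_rfl) hpos
    have hn : ∀ k, (S.mesh.elem e).nij i j k = norm2 ((S.mesh.elem e).nij i j)
        * normalize ((S.mesh.elem e).nij i j) k := fun k => by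
      simp only [normalize, Pi.smul_apply, smul_eq_mul]
      rw [mul_inv_cancel_left₀ h]
    have h1 : S.lowVolumeFlux u σ e i j = norm2 ((S.mesh.elem e).nij i j) •
        (∑ k, normalize ((S.mesh.elem e).nij i j) k •
          (S.gas.flux k (u e i) + S.gas.flux k (u e j))
        - S.gas.dissipation S.ε₀ S.lamMax (u e i) (u e j) (fun k => σ k e i) (fun k => σ k e j)
          (normalize ((S.mesh.elem e).nij i j)) • (u e j - u e i)) := by
      rw [smul_sub, Finset.smul_sum, smul_smul, lowVolumeFlux, graphVisc, mul_comm]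
      congr 1
      exact Finset.sum_congr rfl fun k _ => by rw [smul_smul, ← hn]
    have h2 : ∑ k, (S.mesh.elem e).nij i j k *
        (S.gas.entropyPotential k (u e j) - S.gas.entropyPotential k (u e i))
        = norm2 ((S.mesh.elem e).nij i j) * ∑ k, normalize ((S.mesh.elem e).nij i j) k *
        (S.gas.entropyPotential k (u e j) - S.gas.entropyPotential k (u e i)) := by
      rw [Finset.mul_sum]
      exact Finset.sum_congr rfl fun k _ => by rw [← mul_assoc, ← hn]
    rw [h1, h2, dotProduct_smul, smul_eq_mul, mul_left_comm]
    exact key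

theorem highVolumeFlux_entropy (hu : ∀ e i, u e i ∈ admissible) (e : κ) (i j : ι) :
    (S.v u e j - S.v u e i) ⬝ᵥ S.highVolumeFlux u e i j =
      2 * ∑ k, ((S.mesh.elem e).Q k i j - (S.mesh.elem e).Q k j i) / 2 *
        (S.gas.entropyPotential k (u e j) - S.gas.entropyPotential k (u e i)) := by
  rw [highVolumeFlux, dotProduct_sum, Finset.mul_sum]
  refine Finset.sum_congr rfl fun k _ => ?_
  have h := (S.fS_conservative k).conservative _ (hu e i) _ (hu e j)
  rw [dotProduct_smul, smul_eq_mul, v, v, ← neg_sub (S.gas.entropyVar _), neg_dotProduct, h]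
  ring

/-- Since `∑ k, |B_k| / 2 = (w / 2) (|n₀| + |n₁|)`, the interface flux is `w` times a
Lax-Friedrichs flux whose viscosity is at least the dissipation coefficient. -/
theorem faceFlux_entropy (hu : ∀ e i, u e i ∈ admissible) (e : κ) (f : φ) :
    (S.mesh.outer (S.v u) e f - S.mesh.inner (S.v u) e f) ⬝ᵥ S.faceFlux u σ e f ≤
      ∑ k, (S.mesh.elem e).B k f *
        (S.gas.entropyPotential k (S.mesh.outer u e f)
          - S.gas.entropyPotential k (S.mesh.inner u e f)) := by
  set D := S.gas.dissipation S.ε₀ S.lamMax (S.mesh.inner u e f) (S.mesh.outer u e f)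
      (fun k => S.mesh.inner (σ k) e f) (fun k => S.mesh.outer (σ k) e f)
      ((S.mesh.elem e).normal f) with hD
  have hw := (S.mesh.elem e).wf_pos f
  have hDpos : 0 < D := S.gas.dissipation_pos S.ε₀_pos _ (hu _ _) _ _ _
  have key := mul_le_mul_of_nonneg_left (S.lamMax_bound.entropy_dissipative S.ε₀_pos
    (uL := S.mesh.inner u e f) (uR := S.mesh.outer u e f) (hu _ _) (hu _ _)
    (fun k => S.mesh.inner (σ k) e f) (fun k => S.mesh.outer (σ k) e f)
    ((S.mesh.elem e).normal_unit f) (Λ := (∑ k, |(S.mesh.elem e).normal f k|) * D)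
    (le_mul_of_one_le_left hDpos.le
      (one_le_sum_abs_of_norm2_eq_one ((S.mesh.elem e).normal_unit f))))
    (half_pos hw).le
  have h1 : S.faceFlux u σ e f = ((S.mesh.elem e).wf f / 2) •
      (∑ k, (S.mesh.elem e).normal f k •
          (S.gas.flux k (S.mesh.inner u e f) + S.gas.flux k (S.mesh.outer u e f))
        - ((∑ k, |(S.mesh.elem e).normal f k|) * D) •
          (S.mesh.outer u e f - S.mesh.inner u e f)) := by
    rw [faceFlux, Finset.sum_mul, Finset.sum_smul, ← Finset.sum_sub_distrib, Finset.smul_sum]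
    refine Finset.sum_congr rfl fun k _ => ?_
    rw [faceVisc, ← hD, SBPElement.B, abs_mul, abs_of_pos hw]
    module
  have h2 : ∑ k, (S.mesh.elem e).B k f *
        (S.gas.entropyPotential k (S.mesh.outer u e f)
          - S.gas.entropyPotential k (S.mesh.inner u e f))
      = (S.mesh.elem e).wf f / 2 * (2 * ∑ k, (S.mesh.elem e).normal f k *
        (S.gas.entropyPotential k (S.mesh.outer u e f)
          - S.gas.entropyPotential k (S.mesh.inner u e f))) := by
    rw [Finset.mul_sum, Finset.mul_sum]
    exact Finset.sum_congr rfl fun k _ => by rw [SBPElement.B]; ring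
  rw [h1, h2, dotProduct_smul, smul_eq_mul]
  exact key

/-! ### Residuals and conservation -/

theorem lowResidual_eq (e : κ) (i : ι) : S.lowResidual u σ e i =
    ∑ j, (S.lowVolumeFlux u σ e i j
      - ∑ k, (((S.mesh.elem e).QL k i j - (S.mesh.elem e).QL k j i) / 2) • (σ k e i + σ k e j))
    + S.interface u σ e i := by
  rw [lowResidual]
  congr 1
  refine Finset.sum_congr rfl fun j _ => ?_
  rw [lowVolumeFlux, sub_right_comm, ← Finset.sum_sub_distrib]
  congr 1
  exact Finset.sum_congr rfl fun k _ => by rw [SBPElement.nij]; module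

theorem highResidual_eq (e : κ) (i : ι) : S.highResidual u σ e i =
    ∑ j, (S.highVolumeFlux u e i j
      - ∑ k, (((S.mesh.elem e).Q k i j - (S.mesh.elem e).Q k j i) / 2) • (σ k e i + σ k e j))
    + S.interface u σ e i := by
  rw [highResidual]
  congr 1
  refine Finset.sum_congr rfl fun j _ => ?_
  rw [highVolumeFlux, ← Finset.sum_sub_distrib]
  exact Finset.sum_congr rfl fun k _ => by module

theorem interface_eq (e : κ) (i : ι) : S.interface u σ e i =
    ∑ f with (S.mesh.elem e).faceNode f = i, (S.faceFlux u σ e f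
      - ∑ k, ((S.mesh.elem e).B k f / 2) •
        (S.mesh.inner (σ k) e f + S.mesh.outer (σ k) e f)) := by
  rw [interface]
  refine Finset.sum_congr rfl fun f _ => ?_
  rw [faceFlux, ← Finset.sum_sub_distrib]
  exact Finset.sum_congr rfl fun k _ => by module

theorem sum_interface [Fintype κ] (hu : ∀ e i, u e i ∈ admissible) :
    ∑ e, ∑ i, S.interface u σ e i = 0 := by
  simp only [interface_eq, sum_sum_filter_node]
  refine S.mesh.sum_faces_eq_zero fun e f => ?_
  rw [S.faceFlux_nbr σ hu]
  simp only [PeriodicMesh.B_nbr, PeriodicMesh.inner_nbr, PeriodicMesh.outer_nbr, neg_div, neg_smul,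
    Finset.sum_neg_distrib, add_comm (S.mesh.outer _ e f)]
  abel

/-- The volume terms of both residuals cancel on every single element, so that different
elements may use different blending parameters. -/
theorem sum_lowResidual (hu : ∀ e i, u e i ∈ admissible) (e : κ) :
    ∑ i, S.lowResidual u σ e i = ∑ i, S.interface u σ e i := by
  simp only [lowResidual_eq, Finset.sum_add_distrib (s := (Finset.univ : Finset ι))]
  rw [sum_sum_eq_zero_of_antisymm, zero_add]
  intro i j
  rw [S.lowVolumeFlux_swap σ hu, neg_sub', ← Finset.sum_neg_distrib]
  congr 1
  exact Finset.sum_congr rfl fun k _ => by module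

theorem sum_highResidual (hu : ∀ e i, u e i ∈ admissible) (e : κ) :
    ∑ i, S.highResidual u σ e i = ∑ i, S.interface u σ e i := by
  simp only [highResidual_eq, Finset.sum_add_distrib (s := (Finset.univ : Finset ι))]
  rw [sum_sum_eq_zero_of_antisymm, zero_add]
  intro i j
  rw [S.highVolumeFlux_swap hu, neg_sub', ← Finset.sum_neg_distrib]
  congr 1
  exact Finset.sum_congr rfl fun k _ => by module

theorem sum_limitedResidual [Fintype κ] (hu : ∀ e i, u e i ∈ admissible) (l : κ → ℝ) :
    ∑ e, ∑ i, ((1 - l e) • S.lowResidual u σ e i + l e • S.highResidual u σ e i) = 0 := by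
  rw [← S.sum_interface σ hu]
  refine Finset.sum_congr rfl fun e _ => ?_
  rw [Finset.sum_add_distrib, ← Finset.smul_sum, ← Finset.smul_sum, S.sum_lowResidual σ hu,
    S.sum_highResidual σ hu]
  module

/-! ### Entropy balance of the limited scheme -/

theorem le_sum_dotProduct_lowResidual (hu : ∀ e i, u e i ∈ admissible) (e : κ) :
    ∑ k, (∑ f, (S.mesh.elem e).B k f * (S.mesh.inner (S.v u) e f ⬝ᵥ S.mesh.inner (σ k) e f) / 2
        - ∑ f, (S.mesh.elem e).B k f * S.gas.entropyPotential k (S.mesh.inner u e f)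
        + ∑ i, σ k e i ⬝ᵥ
          ∑ j, (((S.mesh.elem e).QL k i j - (S.mesh.elem e).QL k j i) / 2) • S.v u e j)
      ≤ ∑ i, S.v u e i ⬝ᵥ S.lowResidual u σ e i - ∑ i, S.v u e i ⬝ᵥ S.interface u σ e i := by
  simp only [lowResidual_eq, dotProduct_add (S.v u _ _),
    Finset.sum_add_distrib (s := (Finset.univ : Finset ι)), add_sub_cancel_right]
  exact le_sum_dotProduct_volume (fun k i j => by ring) (S.mesh.elem e).sum_skew_low
    (fun k => σ k e) (ψ := fun k i => S.gas.entropyPotential k (u e i))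
    (S.lowVolumeFlux_swap σ hu e) (S.lowVolumeFlux_entropy σ hu e)

theorem le_sum_dotProduct_highResidual (hu : ∀ e i, u e i ∈ admissible) (e : κ) :
    ∑ k, (∑ f, (S.mesh.elem e).B k f * (S.mesh.inner (S.v u) e f ⬝ᵥ S.mesh.inner (σ k) e f) / 2
        - ∑ f, (S.mesh.elem e).B k f * S.gas.entropyPotential k (S.mesh.inner u e f)
        + ∑ i, σ k e i ⬝ᵥ
          ∑ j, (((S.mesh.elem e).Q k i j - (S.mesh.elem e).Q k j i) / 2) • S.v u e j)
      ≤ ∑ i, S.v u e i ⬝ᵥ S.highResidual u σ e i - ∑ i, S.v u e i ⬝ᵥ S.interface u σ e i := by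
  simp only [highResidual_eq, dotProduct_add (S.v u _ _),
    Finset.sum_add_distrib (s := (Finset.univ : Finset ι)), add_sub_cancel_right]
  exact le_sum_dotProduct_volume (fun k i j => by ring) (S.mesh.elem e).sum_skew_high
    (fun k => σ k e) (ψ := fun k i => S.gas.entropyPotential k (u e i))
    (S.highVolumeFlux_swap hu e) (fun i j => (S.highVolumeFlux_entropy hu e i j).le)

/-- The inviscid interface terms compensate the boundary values of the entropy potential that
the volume terms produce. -/
theorem le_sum_dotProduct_interface [Fintype κ] (hu : ∀ e i, u e i ∈ admissible) :
    ∑ e, ∑ k, (∑ f, (S.mesh.elem e).B k f * S.gas.entropyPotential k (S.mesh.inner u e f)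
        - ∑ f, (S.mesh.elem e).B k f * (S.mesh.inner (S.v u) e f ⬝ᵥ
          (S.mesh.inner (σ k) e f + S.mesh.outer (σ k) e f)) / 2)
      ≤ ∑ e, ∑ i, S.v u e i ⬝ᵥ S.interface u σ e i := by
  have h0 : ∀ e, ∑ i, S.v u e i ⬝ᵥ S.interface u σ e i
      = ∑ f, S.mesh.inner (S.v u) e f ⬝ᵥ S.faceFlux u σ e f
        - ∑ k, ∑ f, (S.mesh.elem e).B k f * (S.mesh.inner (S.v u) e f ⬝ᵥ
          (S.mesh.inner (σ k) e f + S.mesh.outer (σ k) e f)) / 2 := by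
    intro e
    rw [Finset.sum_comm, ← Finset.sum_sub_distrib,
      ← sum_sum_filter_node (S.mesh.elem e).faceNode]
    refine Finset.sum_congr rfl fun i _ => ?_
    rw [interface_eq, dotProduct_sum]
    refine Finset.sum_congr rfl fun f hf => ?_
    have hi : S.mesh.inner (S.v u) e f = S.v u e i := by
      rw [PeriodicMesh.inner, (Finset.mem_filter.1 hf).2]
    rw [hi, dotProduct_sub, dotProduct_sum]
    congr 1
    exact Finset.sum_congr rfl fun k _ => by rw [dotProduct_smul, smul_eq_mul]; ring
  have h1 := S.mesh.sum_faces_dotProduct (v := S.v u) (S.faceFlux_nbr σ hu)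
  have h2 : ∑ e, ∑ f, (S.mesh.outer (S.v u) e f - S.mesh.inner (S.v u) e f) ⬝ᵥ S.faceFlux u σ e f
      ≤ -(2 * ∑ e, ∑ k, ∑ f,
        (S.mesh.elem e).B k f * S.gas.entropyPotential k (S.mesh.inner u e f)) := by
    refine (Finset.sum_le_sum fun e _ => Finset.sum_le_sum fun f _ =>
      S.faceFlux_entropy σ hu e f).trans_eq ?_
    have h3 : ∀ k, ∑ e, ∑ f, (S.mesh.elem e).B k f *
        S.gas.entropyPotential k (S.mesh.outer u e f) = -∑ e, ∑ f, (S.mesh.elem e).B k f *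
        S.gas.entropyPotential k (S.mesh.inner u e f) := fun k =>
      S.mesh.sum_faces_B_mul_outer k fun e i => S.gas.entropyPotential k (u e i)
    simp only [Finset.sum_comm (s := (Finset.univ : Finset φ)) (t := (Finset.univ : Finset (Fin 2)))]
    rw [Finset.sum_comm, Finset.sum_comm (s := (Finset.univ : Finset κ))]
    simp only [mul_sub, Finset.sum_sub_distrib, h3, Fin.sum_univ_two]
    ring
  simp only [h0, Finset.sum_sub_distrib, h1]
  linarith

/-- The rate of entropy production of the limited residual is at least the viscous dissipation.
The boundary potentials cancel, and of the viscous terms only `Θ_kᵀ M σ_k` remains: the interface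
products `B v σ⁺` and `B v⁺ σ` have opposite sums, as `B` changes sign across an interface. -/
theorem viscousDissipation_le [Fintype κ] (l : κ → ℝ) (hl : ∀ e, l e ∈ Icc (0 : ℝ) 1)
    (hu : ∀ e i, u e i ∈ admissible) :
    S.viscousDissipation l u ≤ ∑ e, ∑ i, S.v u e i ⬝ᵥ
      ((1 - l e) • S.lowResidual u (S.sigma l u) e i
        + l e • S.highResidual u (S.sigma l u) e i) := by
  set σ := S.sigma l u with hσ
  have hΘ : ∀ k e i, (S.mesh.elem e).m i • S.Theta l u k e i =
      (1 - l e) • ∑ j, (((S.mesh.elem e).QL k i j - (S.mesh.elem e).QL k j i) / 2) • S.v u e j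
      + l e • ∑ j, (((S.mesh.elem e).Q k i j - (S.mesh.elem e).Q k j i) / 2) • S.v u e j
      + ∑ f with (S.mesh.elem e).faceNode f = i,
        ((S.mesh.elem e).B k f / 2) • S.mesh.outer (S.v u) e f := fun k e i => by
    rw [Theta, smul_add, smul_comm _ (1 - l e), smul_comm _ (l e),
      PeriodicMesh.m_smul_ldgGradient, PeriodicMesh.m_smul_ldgGradient]
    module
  have hV : S.viscousDissipation l u = ∑ e, ∑ k, ∑ i,
      σ k e i ⬝ᵥ ((S.mesh.elem e).m i • S.Theta l u k e i) := by
    rw [viscousDissipation, Finset.sum_comm (s := (Finset.univ : Finset κ))]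
    refine Finset.sum_congr rfl fun k _ => ?_
    simp only [PeriodicMesh.integral]
    rw [Finset.sum_comm]
    refine Finset.sum_congr rfl fun e _ => ?_
    rw [Finset.sum_comm]
    refine Finset.sum_congr rfl fun i _ => ?_
    rw [hσ, sigma, dotProduct_smul, sum_dotProduct, Finset.smul_sum]
    exact Finset.sum_congr rfl fun j _ => by rw [dotProduct_comm]
  have hface : ∀ e k, ∑ i, σ k e i ⬝ᵥ ∑ f with (S.mesh.elem e).faceNode f = i,
        ((S.mesh.elem e).B k f / 2) • S.mesh.outer (S.v u) e f
      = ∑ f, (S.mesh.elem e).B k f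
        * (S.mesh.inner (σ k) e f ⬝ᵥ S.mesh.outer (S.v u) e f) / 2 := fun e k => by
    rw [← sum_sum_filter_node (S.mesh.elem e).faceNode]
    refine Finset.sum_congr rfl fun i _ => ?_
    rw [dotProduct_sum]
    refine Finset.sum_congr rfl fun f hf => ?_
    rw [PeriodicMesh.inner, (Finset.mem_filter.1 hf).2, dotProduct_smul, smul_eq_mul]
    ring
  have hswap : ∀ k, ∑ e, ∑ f, (S.mesh.elem e).B k f *
        (S.mesh.inner (S.v u) e f ⬝ᵥ S.mesh.outer (σ k) e f) / 2
      = -∑ e, ∑ f, (S.mesh.elem e).B k f *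
        (S.mesh.inner (σ k) e f ⬝ᵥ S.mesh.outer (S.v u) e f) / 2 := fun k => by
    rw [← S.mesh.sum_faces_nbr fun e f => (S.mesh.elem e).B k f *
        (S.mesh.inner (S.v u) e f ⬝ᵥ S.mesh.outer (σ k) e f) / 2]
    simp only [PeriodicMesh.B_nbr, PeriodicMesh.inner_nbr, PeriodicMesh.outer_nbr, neg_mul,
      neg_div, Finset.sum_neg_distrib, dotProduct_comm (S.mesh.outer (S.v u) _ _)]
  have hint := S.le_sum_dotProduct_interface σ hu
  have hvol : ∀ e, ∑ k, (∑ f, (S.mesh.elem e).B k f *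
          (S.mesh.inner (S.v u) e f ⬝ᵥ S.mesh.inner (σ k) e f) / 2
        - ∑ f, (S.mesh.elem e).B k f * S.gas.entropyPotential k (S.mesh.inner u e f)
        + ∑ i, σ k e i ⬝ᵥ ((S.mesh.elem e).m i • S.Theta l u k e i)
        - ∑ f, (S.mesh.elem e).B k f
          * (S.mesh.inner (σ k) e f ⬝ᵥ S.mesh.outer (S.v u) e f) / 2)
      + ∑ i, S.v u e i ⬝ᵥ S.interface u σ e i
      ≤ ∑ i, S.v u e i ⬝ᵥ
      ((1 - l e) • S.lowResidual u σ e i + l e • S.highResidual u σ e i) := fun e => by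
    have a := mul_le_mul_of_nonneg_left (S.le_sum_dotProduct_lowResidual σ hu e)
      (sub_nonneg.2 (hl e).2)
    have b := mul_le_mul_of_nonneg_left (S.le_sum_dotProduct_highResidual σ hu e) (hl e).1
    simp only [hΘ, dotProduct_add, dotProduct_smul, smul_eq_mul, Finset.sum_add_distrib, hface,
      ← Finset.mul_sum, Fin.sum_univ_two] at a b ⊢
    linarith
  have hsum := Finset.sum_le_sum fun e (_ : e ∈ Finset.univ) => hvol e
  have s0 := hswap 0
  have s1 := hswap 1
  rw [hV]
  simp only [Finset.sum_add_distrib, Finset.sum_sub_distrib, Fin.sum_univ_two, dotProduct_add,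
    mul_add, add_div] at hint hsum ⊢
  linarith

end Scheme
end ESDG

theorem theorem6p2 {κ ι φ : Type*} [Fintype κ] [Fintype ι] [DecidableEq ι] [Fintype φ]
    [DecidableEq φ] (S : Scheme κ ι φ) :
    -- one step of the limited scheme: elementwise combination, and conservation
    (∀ (τ : ℝ) (l : κ → ℝ) (u : κ → ι → State) (σ : Fin 2 → κ → ι → State),
      0 < τ → (∀ e, l e ∈ Set.Icc (0 : ℝ) 1) → (∀ e i, u e i ∈ admissible) →
        (∀ e i, S.limitedUpdate τ l u σ e i
          = (1 - l e) • S.lowUpdate τ u σ e i + l e • S.highUpdate τ u σ e i) ∧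
        S.mesh.integral (S.limitedUpdate τ l u σ) = S.mesh.integral u) ∧
    -- the semi-discrete limited scheme: conservation, and the entropy balance
    (∀ (l : ℝ → κ → ℝ) (u : ℝ → κ → ι → State) (du : κ → ι → State) (t : ℝ),
      (∀ e, l t e ∈ Set.Icc (0 : ℝ) 1) → (∀ e i, u t e i ∈ admissible) →
      (∀ e i, HasDerivAt (fun s => u s e i) (du e i) t) → S.SemiDiscrete (l t) (u t) du →
        HasDerivAt (fun s => S.mesh.integral (u s)) 0 t ∧
        ∃ d : ℝ,
          HasDerivAt (fun s => S.mesh.integral fun e i => S.gas.entropy (u s e i)) d t ∧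
          d ≤ -S.viscousDissipation (l t) (u t)) := by
  refine ⟨fun τ l u σ _ _ hu => ⟨fun e i => ?_, ?_⟩, fun l u du t hl hu hdu hS => ?_⟩
  · simp only [Scheme.limitedUpdate, Scheme.lowUpdate, Scheme.highUpdate]
    module
  · have h : ∀ e i, (S.mesh.elem e).m i • S.limitedUpdate τ l u σ e i
        = (S.mesh.elem e).m i • u e i
          - τ • ((1 - l e) • S.lowResidual u σ e i + l e • S.highResidual u σ e i) := by
      intro e i
      have hm : (S.mesh.elem e).m i * (τ / (S.mesh.elem e).m i) = τ :=
        mul_div_cancel₀ _ ((S.mesh.elem e).m_pos i).ne'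
      simp only [Scheme.limitedUpdate, Scheme.lowUpdate, smul_add, smul_sub, smul_smul,
        ← mul_assoc, hm]
      module
    simp only [PeriodicMesh.integral, h, Finset.sum_sub_distrib, ← Finset.smul_sum]
    rw [S.sum_limitedResidual σ hu, smul_zero, sub_zero]
  · have hm : ∀ e i, (S.mesh.elem e).m i • du e i
        = -((1 - l t e) • S.lowResidual (u t) (S.sigma (l t) (u t)) e i
          + l t e • S.highResidual (u t) (S.sigma (l t) (u t)) e i) := fun e i => by
      have := hS e i
      rw [add_assoc] at this
      exact eq_neg_of_add_eq_zero_left this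
    refine ⟨?_, ∑ e, ∑ i, (S.mesh.elem e).m i • (S.v (u t) e i ⬝ᵥ du e i), ?_, ?_⟩
    · have h : HasDerivAt (fun s => S.mesh.integral (u s))
          (∑ e, ∑ i, (S.mesh.elem e).m i • du e i) t :=
        HasDerivAt.fun_sum fun e _ => HasDerivAt.fun_sum fun i _ => (hdu e i).fun_const_smul _
      simpa only [hm, Finset.sum_neg_distrib, S.sum_limitedResidual _ hu, neg_zero] using h
    · refine HasDerivAt.fun_sum fun e _ => HasDerivAt.fun_sum fun i _ =>
        HasDerivAt.fun_const_smul _ ?_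
      have h := (S.gas.hasFDerivAt_entropy (hu e i)).comp_hasDerivAt t (hdu e i)
      simpa [dotProduct, Scheme.v] using! h
    · have h := S.viscousDissipation_le (l t) hl hu
      simp only [← dotProduct_smul, hm, dotProduct_neg, Finset.sum_neg_distrib]
      exact neg_le_neg h
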